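/- Let $M$ and $N$ be smooth ($C^\infty$) manifolds without boundary (Hausdorff, second countable, finite-dimensional, not assumed connected, compact or of the same dimension). For a smooth manifold $X$ and an integer $k\ge 0$ let $\Omega^k(X)$ be the space of smooth real-valued differential $k$-forms on $X$ (with $\Omega^{-1}(X)=0$), $d$ the exterior derivative, and put \[Z^k(X)=\ker\big(d:\Omega^k(X)\to\Omega^{k+1}(X)\big),\qquad B^k(X)=\operatorname{im}\big(d:\Omega^{k-1}(X)\to\Omega^k(X)\big),\] \[\overline{Z}^k(X)=\{\lambda\in Z^k(X) : \text{there are a compact } K\subseteq X \text{ and } \nu\in\Omega^{k-1}(X\setminus K) \text{ with } d\nu=\lambda|_{X\setminus K}\},\] so that $B^k(X)\subseteq\overline{Z}^k(X)$, and \[c_k(X)=\dim_{\mathbb R}\,\overline{Z}^k(X)/B^k(X),\] a possibly infinite cardinal. If $M$ and $N$ are homeomorphic, then $c_k(M)=c_k(N)$ for every integer $k\ge 0$. -/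

import Mathlib

open scoped Manifold ContDiff Topology

noncomputable section

namespace DiffForm

variable (E : Type*) [NormedAddCommGroup E] [NormedSpace ℝ E]
  (M : Type*) [TopologicalSpace M] [ChartedSpace E M]

/-- Not necessarily smooth (nor continuous) real `k`-forms on a manifold `M` modelled on `E`:
at each point, an alternating `k`-linear form on the tangent space. -/
def RawForm (k : ℕ) : Type _ :=
  ∀ x : M, TangentSpace 𝓘(ℝ, E) x [⋀^Fin k]→L[ℝ] ℝ

variable {E M} {k : ℕ}

/-- Forms are added and scaled pointwise. -/
instance : AddCommGroup (RawForm E M k) :=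
  inferInstanceAs (AddCommGroup (∀ x : M, TangentSpace 𝓘(ℝ, E) x [⋀^Fin k]→L[ℝ] ℝ))

instance : Module ℝ (RawForm E M k) :=
  inferInstanceAs (Module ℝ (∀ x : M, TangentSpace 𝓘(ℝ, E) x [⋀^Fin k]→L[ℝ] ℝ))

lemma add_apply (θ η : RawForm E M k) (x : M) : (θ + η) x = θ x + η x := rfl

lemma smul_apply (r : ℝ) (θ : RawForm E M k) (x : M) : (r • θ) x = r • θ x := rfl

lemma zero_apply (x : M) : (0 : RawForm E M k) x = 0 := rfl

/-- The expression of `θ` in the chart `φ`, i.e. the pullback of `θ` by `φ⁻¹`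
(meaningful on `φ.target`). -/
def inChart (φ : OpenPartialHomeomorph M E) (θ : RawForm E M k) (y : E) :
    E [⋀^Fin k]→L[ℝ] ℝ :=
  (θ (φ.symm y)).compContinuousLinearMap
    (mfderiv 𝓘(ℝ, E) 𝓘(ℝ, E) φ.symm y : E →L[ℝ] TangentSpace 𝓘(ℝ, E) (φ.symm y))

/-- `θ` is smooth on the open set `U`: all its chart expressions are. -/
def IsSmoothOn (U : Set M) (θ : RawForm E M k) : Prop :=
  ∀ φ ∈ atlas E M, ContDiffOn ℝ ∞ (inChart φ θ) (φ.target ∩ φ.symm ⁻¹' U)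

/-- The exterior derivative, computed at `x` in the preferred chart at `x`
(see `inChart_d` for the independence of the chart). -/
def d (θ : RawForm E M k) : RawForm E M (k + 1) := fun x =>
  (extDeriv (inChart (chartAt E x) θ) (chartAt E x x)).compContinuousLinearMap
    (mfderiv 𝓘(ℝ, E) 𝓘(ℝ, E) (chartAt E x) x : TangentSpace 𝓘(ℝ, E) x →L[ℝ] E)

/-- `θ` is exact on the open set `U`: it is `dν` there, for some smooth `(k-1)`-form `ν` on `U`
(the values of `ν` off `U` are irrelevant). There are no nonzero forms of degree `-1`, so a
`0`-form is exact on `U` when it vanishes there. -/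
def IsExactOn (U : Set M) : {k : ℕ} → RawForm E M k → Prop
  | 0, θ => ∀ x ∈ U, θ x = 0
  | _ + 1, θ => ∃ ν : RawForm E M _, IsSmoothOn U ν ∧ ∀ x ∈ U, d ν x = θ x

/-! ### Linearity -/

lemma inChart_add (φ : OpenPartialHomeomorph M E) (θ η : RawForm E M k) :
    inChart φ (θ + η) = inChart φ θ + inChart φ η := rfl

lemma inChart_smul (φ : OpenPartialHomeomorph M E) (c : ℝ) (θ : RawForm E M k) :
    inChart φ (c • θ) = c • inChart φ θ := rfl

lemma inChart_zero (φ : OpenPartialHomeomorph M E) :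
    inChart φ (0 : RawForm E M k) = 0 := rfl

lemma IsSmoothOn.zero (U : Set M) : IsSmoothOn U (0 : RawForm E M k) := by
  intro φ _
  rw [inChart_zero]
  exact contDiffOn_const

lemma IsSmoothOn.add {U : Set M} {θ η : RawForm E M k} (hθ : IsSmoothOn U θ)
    (hη : IsSmoothOn U η) : IsSmoothOn U (θ + η) := by
  intro φ hφ
  rw [inChart_add]
  exact (hθ φ hφ).add (hη φ hφ)

lemma IsSmoothOn.smul {U : Set M} {θ : RawForm E M k} (c : ℝ) (hθ : IsSmoothOn U θ) :
    IsSmoothOn U (c • θ) := by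
  intro φ hφ
  rw [inChart_smul]
  exact (hθ φ hφ).const_smul c

lemma IsSmoothOn.mono {U V : Set M} {θ : RawForm E M k} (hθ : IsSmoothOn U θ) (h : V ⊆ U) :
    IsSmoothOn V θ := fun φ hφ =>
  (hθ φ hφ).mono (Set.inter_subset_inter_right _ (Set.preimage_mono h))

lemma IsSmoothOn.contDiffAt {U : Set M} (hU : IsOpen U) {θ : RawForm E M k}
    (hθ : IsSmoothOn U θ) {φ : OpenPartialHomeomorph M E} (hφ : φ ∈ atlas E M)
    {y : E} (hy : y ∈ φ.target) (hyU : φ.symm y ∈ U) : ContDiffAt ℝ ∞ (inChart φ θ) y :=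
  (hθ φ hφ).contDiffAt ((φ.isOpen_inter_preimage_symm hU).mem_nhds ⟨hy, hyU⟩)

lemma IsSmoothOn.differentiableAt {U : Set M} (hU : IsOpen U) {θ : RawForm E M k}
    (hθ : IsSmoothOn U θ) {x : M} (hx : x ∈ U) :
    DifferentiableAt ℝ (inChart (chartAt E x) θ) (chartAt E x x) :=
  (hθ.contDiffAt hU (chart_mem_atlas E x) (mem_chart_target E x)
    (by simpa using hx)).differentiableAt (by simp)

lemma d_zero : d (0 : RawForm E M k) = 0 := by
  funext x
  have h : extDeriv (0 : E → E [⋀^Fin k]→L[ℝ] ℝ) (chartAt E x x) = 0 := by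
    simpa using extDeriv_smul (0 : ℝ) (0 : E → E [⋀^Fin k]→L[ℝ] ℝ) (x := chartAt E x x)
  simp only [d, inChart_zero, h]
  rfl

lemma d_smul (c : ℝ) (θ : RawForm E M k) : d (c • θ) = c • d θ := by
  funext x
  simp only [d, inChart_smul, extDeriv_smul]
  rfl

lemma d_add {U : Set M} (hU : IsOpen U) {θ η : RawForm E M k} (hθ : IsSmoothOn U θ)
    (hη : IsSmoothOn U η) {x : M} (hx : x ∈ U) : d (θ + η) x = d θ x + d η x := by
  simp only [d, inChart_add]
  rw [extDeriv_add (hθ.differentiableAt hU hx) (hη.differentiableAt hU hx)]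
  rfl

lemma IsExactOn.zero (U : Set M) : ∀ {k : ℕ}, IsExactOn U (0 : RawForm E M k)
  | 0 => fun _ _ => rfl
  | _ + 1 => ⟨0, .zero U, fun x _ => by rw [d_zero]⟩

lemma IsExactOn.add {U : Set M} (hU : IsOpen U) : ∀ {k : ℕ} {θ η : RawForm E M k},
    IsExactOn U θ → IsExactOn U η → IsExactOn U (θ + η)
  | 0, _, _, hθ, hη => fun x hx => by rw [add_apply, hθ x hx, hη x hx, add_zero]
  | _ + 1, _, _, ⟨α, hα, hα'⟩, ⟨β, hβ, hβ'⟩ => ⟨α + β, hα.add hβ, fun x hx => by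
      rw [d_add hU hα hβ hx, hα' x hx, hβ' x hx, add_apply]⟩

lemma IsExactOn.smul {U : Set M} (c : ℝ) : ∀ {k : ℕ} {θ : RawForm E M k},
    IsExactOn U θ → IsExactOn U (c • θ)
  | 0, _, hθ => fun x hx => by rw [smul_apply, hθ x hx, smul_zero]
  | _ + 1, _, ⟨α, hα, hα'⟩ => ⟨c • α, hα.smul c, fun x hx => by
      rw [d_smul, smul_apply, hα' x hx, smul_apply]⟩

lemma IsExactOn.mono {U V : Set M} (h : V ⊆ U) : ∀ {k : ℕ} {θ : RawForm E M k},
    IsExactOn U θ → IsExactOn V θ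
  | 0, _, hθ => fun x hx => hθ x (h hx)
  | _ + 1, _, ⟨α, hα, hα'⟩ => ⟨α, hα.mono h, fun x hx => hα' x (h hx)⟩

/-! ### The spaces of forms and the invariant -/

variable (E M k)

/-- The space `Ω^k(M)` of smooth `k`-forms. -/
def smoothForms : Submodule ℝ (RawForm E M k) where
  carrier := {θ | IsSmoothOn Set.univ θ}
  zero_mem' := .zero _
  add_mem' := .add
  smul_mem' c _ := .smul c

/-- The space `Z^k(M)` of closed smooth `k`-forms. -/
def closedForms : Submodule ℝ (RawForm E M k) where
  carrier := {θ | θ ∈ smoothForms E M k ∧ d θ = 0}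
  zero_mem' := ⟨zero_mem _, d_zero⟩
  add_mem' := fun {a b} ha hb => ⟨add_mem ha.1 hb.1, by
    funext x
    rw [d_add isOpen_univ ha.1 hb.1 (Set.mem_univ x), ha.2, hb.2]
    exact add_zero _⟩
  smul_mem' c _ h := ⟨Submodule.smul_mem _ c h.1, by rw [d_smul, h.2, smul_zero]⟩

/-- The space `B^k(M)` of exact `k`-forms, the image of `d` on smooth `(k-1)`-forms
(zero for `k = 0`). -/
def exactForms : Submodule ℝ (RawForm E M k) where
  carrier := {θ | IsExactOn Set.univ θ}
  zero_mem' := .zero _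
  add_mem' := .add isOpen_univ
  smul_mem' c _ := .smul c

/-- The space of closed `k`-forms on `M` that are exact on the complement of some compact set. -/
def closedFormsExactAtInfinity [T2Space M] : Submodule ℝ (RawForm E M k) where
  carrier := {θ | θ ∈ closedForms E M k ∧ ∃ K : Set M, IsCompact K ∧ IsExactOn Kᶜ θ}
  zero_mem' := ⟨zero_mem _, ∅, isCompact_empty, .zero _⟩
  add_mem' := by
    rintro a b ⟨ha, K, hK, ha'⟩ ⟨hb, L, hL, hb'⟩
    exact ⟨add_mem ha hb, K ∪ L, hK.union hL, .add (hK.union hL).isClosed.isOpen_compl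
      (ha'.mono (Set.compl_subset_compl.2 Set.subset_union_left))
      (hb'.mono (Set.compl_subset_compl.2 Set.subset_union_right))⟩
  smul_mem' := by
    rintro c a ⟨ha, K, hK, ha'⟩
    exact ⟨Submodule.smul_mem _ c ha, K, hK, ha'.smul c⟩

/-- The quotient of the closed `k`-forms that are exact outside a compact set by the exact
`k`-forms (which are among them: `exactForms_le`). -/
abbrev CohomologyExactAtInfinity [T2Space M] : Type _ :=
  closedFormsExactAtInfinity E M k ⧸
    (exactForms E M k).submoduleOf (closedFormsExactAtInfinity E M k)

/-- The invariant `c_k(M)`, the dimension of the above quotient, as a cardinal. -/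
def c [T2Space M] : Cardinal :=
  Module.rank ℝ (CohomologyExactAtInfinity E M k)

/-! ### Independence of the chart, and `d ∘ d = 0` -/

variable {E M k}

variable [IsManifold 𝓘(ℝ, E) ∞ M]

lemma two_le_infty : (2 : ℕ∞ω) ≤ ∞ := WithTop.coe_le_coe.2 (le_top (a := (2 : ℕ∞)))

lemma mdiff_chart {φ : OpenPartialHomeomorph M E} (hφ : φ ∈ atlas E M) {x : M}
    (hx : x ∈ φ.source) : MDifferentiableAt 𝓘(ℝ, E) 𝓘(ℝ, E) φ x :=
  (contMDiffAt_of_mem_maximalAtlas (n := ∞)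
    (IsManifold.subset_maximalAtlas hφ) hx).mdifferentiableAt (by simp)

lemma mdiff_chart_symm {φ : OpenPartialHomeomorph M E} (hφ : φ ∈ atlas E M) {y : E}
    (hy : y ∈ φ.target) : MDifferentiableAt 𝓘(ℝ, E) 𝓘(ℝ, E) φ.symm y :=
  (contMDiffAt_symm_of_mem_maximalAtlas (n := ∞)
    (IsManifold.subset_maximalAtlas hφ) hy).mdifferentiableAt (by simp)

lemma inChart_eq (θ : RawForm E M k) {φ ψ : OpenPartialHomeomorph M E}
    (hφ : φ ∈ atlas E M) (hψ : ψ ∈ atlas E M) {y : E} (hy : y ∈ φ.target)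
    (hy' : φ.symm y ∈ ψ.source) :
    inChart φ θ y =
      (inChart ψ θ ((ψ ∘ φ.symm) y)).compContinuousLinearMap (fderiv ℝ (ψ ∘ φ.symm) y) := by
  have hT : MDifferentiableAt 𝓘(ℝ, E) 𝓘(ℝ, E) (ψ ∘ φ.symm) y :=
    (mdiff_chart hψ hy').comp y (mdiff_chart_symm hφ hy)
  have hT' : (ψ ∘ φ.symm) y ∈ ψ.target := ψ.map_source hy'
  have hev : φ.symm =ᶠ[𝓝 y] ψ.symm ∘ (ψ ∘ φ.symm) := by
    filter_upwards [φ.symm.continuousAt hy (ψ.open_source.mem_nhds hy')] with z hz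
    exact (ψ.left_inv hz).symm
  have hD : (mfderiv 𝓘(ℝ, E) 𝓘(ℝ, E) φ.symm y : E →L[ℝ] E) =
      (mfderiv 𝓘(ℝ, E) 𝓘(ℝ, E) ψ.symm ((ψ ∘ φ.symm) y) : E →L[ℝ] E).comp
        (fderiv ℝ (ψ ∘ φ.symm) y) := by
    have h1 := hev.mfderiv_eq (I := 𝓘(ℝ, E)) (I' := 𝓘(ℝ, E))
    have h2 := mfderiv_comp y (mdiff_chart_symm hψ hT') hT
    rw [mfderiv_eq_fderiv] at h2
    exact h1.trans h2
  have hp : ψ.symm ((ψ ∘ φ.symm) y) = φ.symm y := ψ.left_inv hy'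
  let θ' : M → E [⋀^Fin k]→L[ℝ] ℝ := θ
  change (θ' (φ.symm y)).compContinuousLinearMap
      (mfderiv 𝓘(ℝ, E) 𝓘(ℝ, E) φ.symm y : E →L[ℝ] E) =
    ((θ' (ψ.symm ((ψ ∘ φ.symm) y))).compContinuousLinearMap
      (mfderiv 𝓘(ℝ, E) 𝓘(ℝ, E) ψ.symm ((ψ ∘ φ.symm) y) : E →L[ℝ] E)).compContinuousLinearMap
        (fderiv ℝ (ψ ∘ φ.symm) y)
  rw [hD, hp]
  rfl

/-- In every chart the manifold exterior derivative is the one of the model space. -/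
lemma inChart_d {U : Set M} (hU : IsOpen U) {θ : RawForm E M k} (hθ : IsSmoothOn U θ)
    {φ : OpenPartialHomeomorph M E} (hφ : φ ∈ atlas E M) {y : E} (hy : y ∈ φ.target)
    (hyU : φ.symm y ∈ U) : inChart φ (d θ) y = extDeriv (inChart φ θ) y := by
  set ψ := chartAt E (φ.symm y) with hψdef
  have hψ : ψ ∈ atlas E M := chart_mem_atlas E _
  have hy' : φ.symm y ∈ ψ.source := mem_chart_source E _
  have hT : ContDiffAt ℝ ∞ (ψ ∘ φ.symm) y :=
    ((contMDiffAt_of_mem_maximalAtlas (I := 𝓘(ℝ, E)) (n := ∞)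
      (IsManifold.subset_maximalAtlas hψ) hy').comp y
      (contMDiffAt_symm_of_mem_maximalAtlas (n := ∞)
        (IsManifold.subset_maximalAtlas hφ) hy)).contDiffAt
  have hev : inChart φ θ =ᶠ[𝓝 y] fun z =>
      (inChart ψ θ ((ψ ∘ φ.symm) z)).compContinuousLinearMap (fderiv ℝ (ψ ∘ φ.symm) z) := by
    filter_upwards [φ.open_target.mem_nhds hy,
      φ.symm.continuousAt hy (ψ.open_source.mem_nhds hy')] with z hz hz'
    exact inChart_eq θ hφ hψ hz hz'
  have hD : fderiv ℝ (ψ ∘ φ.symm) y =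
      (mfderiv 𝓘(ℝ, E) 𝓘(ℝ, E) ψ (φ.symm y) : E →L[ℝ] E).comp
        (mfderiv 𝓘(ℝ, E) 𝓘(ℝ, E) φ.symm y : E →L[ℝ] E) := by
    have h2 := mfderiv_comp y (mdiff_chart hψ hy') (mdiff_chart_symm hφ hy)
    rw [mfderiv_eq_fderiv] at h2
    exact h2
  rw [hev.extDeriv_eq, extDeriv_pullback (f := ψ ∘ φ.symm) (r := ∞) (hθ.differentiableAt hU hyU) hT (by simpa using two_le_infty), hD]
  rfl

lemma IsSmoothOn.d {U : Set M} (hU : IsOpen U) {θ : RawForm E M k} (hθ : IsSmoothOn U θ) :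
    IsSmoothOn U (d θ) := by
  intro φ hφ
  refine ContDiffOn.congr (f := extDeriv (inChart φ θ)) ?_
    fun y hy => inChart_d hU hθ hφ hy.1 hy.2
  intro y hy
  refine ContDiffAt.contDiffWithinAt ?_
  have h : ContDiffAt ℝ ∞ (fderiv ℝ (inChart φ θ)) y :=
    (hθ.contDiffAt hU hφ hy.1 hy.2).fderiv_right (by simp)
  exact (ContinuousAlternatingMap.alternatizeUncurryFinCLM ℝ E ℝ).contDiff.contDiffAt.comp y h

lemma d_d {U : Set M} (hU : IsOpen U) {θ : RawForm E M k} (hθ : IsSmoothOn U θ)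
    {x : M} (hx : x ∈ U) : DiffForm.d (DiffForm.d θ) x = 0 := by
  have hφ := chart_mem_atlas E x
  have hy := mem_chart_target E x
  have hyU : (chartAt E x).symm (chartAt E x x) ∈ U := by simpa using hx
  have hev : inChart (chartAt E x) (DiffForm.d θ) =ᶠ[𝓝 (chartAt E x x)]
      extDeriv (inChart (chartAt E x) θ) := by
    filter_upwards [((chartAt E x).isOpen_inter_preimage_symm hU).mem_nhds ⟨hy, hyU⟩] with z hz
    exact inChart_d hU hθ hφ hz.1 hz.2
  have h0 : extDeriv (inChart (chartAt E x) (DiffForm.d θ)) (chartAt E x x) = 0 := by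
    rw [hev.extDeriv_eq]
    exact extDeriv_extDeriv_apply (hθ.contDiffAt hU hφ hy hyU) (by simpa using two_le_infty)
  rw [DiffForm.d, h0]
  rfl

lemma exactForms_le [T2Space M] : exactForms E M k ≤ closedFormsExactAtInfinity E M k := by
  intro θ hθ
  refine ⟨?_, ∅, isCompact_empty, hθ.mono (Set.subset_univ _)⟩
  cases k with
  | zero =>
    obtain rfl : θ = 0 := funext fun x => hθ x trivial
    exact zero_mem _
  | succ k =>
    obtain ⟨ν, hν, hd⟩ := hθ
    obtain rfl : DiffForm.d ν = θ := funext fun x => hd x trivial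
    exact ⟨hν.d isOpen_univ, funext fun x => d_d isOpen_univ hν trivial⟩

end DiffForm

end

universe u v

/-!
Consider the double complex whose entries are germs near the diagonal of functions of several points
and one further base point, with values in the `q`-forms at the base point. Its differentials are
the exterior derivative `d` in the base point and the Alexander–Spanier coboundary `δ` in the other
points. By the Poincaré lemma the `d`-complexes are exact, with kernel the germs that do not depend
on the base point, so that they resolve the Alexander–Spanier complex; by a partition of unity the
`δ`-complexes are exact, and they resolve the de Rham complex. Both facts hold over every open set,
in particular over the complement of every compact set, and the resulting zigzag commutes with
restriction. Hence the closed forms that are exact outside a compact set, modulo exact forms,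
correspond to the Alexander–Spanier classes that vanish outside a compact set, and the latter only
depend on the topology.
-/

noncomputable section

namespace DiffForm

open TopologicalSpace (Opens Compacts)

/-! ### The Poincaré lemma -/

section ParametricIntegral

open MeasureTheory Set

theorem hasFDerivAt_intervalIntegral_of_continuousOn {E G : Type*} [NormedAddCommGroup E]
    [NormedSpace ℝ E] [NormedAddCommGroup G] [NormedSpace ℝ G] {W : Set (E × ℝ)} (hW : IsOpen W)
    {f : E → ℝ → G} {f' : E → ℝ → E →L[ℝ] G} (hf : ContinuousOn (Function.uncurry f) W)
    (hf' : ContinuousOn (Function.uncurry f') W)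
    (hderiv : ∀ x t, (x, t) ∈ W → HasFDerivAt (f · t) (f' x t) x) {a b : ℝ} {y : E}
    (hy : ∀ t ∈ uIcc a b, (y, t) ∈ W) :
    HasFDerivAt (fun x => ∫ t in a..b, f x t) (∫ t in a..b, f' y t) y := by
  have hfx : ∀ x, (∀ t ∈ uIcc a b, (x, t) ∈ W) → ContinuousOn (f x) (uIcc a b) := fun x hx =>
    hf.comp (Continuous.prodMk_right x).continuousOn hx
  have hf'y : ContinuousOn (f' y) (uIcc a b) :=
    hf'.comp (Continuous.prodMk_right y).continuousOn hy
  obtain ⟨C, hC⟩ := isCompact_uIcc.exists_bound_of_continuousOn hf'y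
  have hnear : ∀ᶠ x in 𝓝 y, ∀ t ∈ uIcc a b, (x, t) ∈ W ∧ ‖f' x t‖ < C + 1 := by
    refine isCompact_uIcc.eventually_forall_of_forall_eventually
      (P := fun x t => (x, t) ∈ W ∧ ‖f' x t‖ < C + 1) fun t ht => ?_
    have hWt := hW.mem_nhds (hy t ht)
    exact (Filter.eventually_of_mem hWt fun _ h => h).and
      ((hf'.continuousAt hWt).norm.eventually_lt_const ((hC t ht).trans_lt (lt_add_one C)))
  refine intervalIntegral.hasFDerivAt_integral_of_dominated_of_fderiv_le (F' := f')
    (bound := fun _ => C + 1) hnear ?_ (hfx y hy).intervalIntegrable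
    ((hf'y.mono uIoc_subset_uIcc).aestronglyMeasurable measurableSet_uIoc)
    (.of_forall fun t ht x hx => (hx t (uIoc_subset_uIcc ht)).2.le) intervalIntegrable_const
    (.of_forall fun t ht x hx => hderiv x t (hx t (uIoc_subset_uIcc ht)).1)
  filter_upwards [hnear] with x hx
  exact ((hfx x fun t ht => (hx t ht).1).mono uIoc_subset_uIcc).aestronglyMeasurable
    measurableSet_uIoc

theorem hasFDerivAt_left_of_contDiffOn {E G : Type*} [NormedAddCommGroup E] [NormedSpace ℝ E]
    [NormedAddCommGroup G] [NormedSpace ℝ G] {W : Set (E × ℝ)} (hW : IsOpen W) {f : E → ℝ → G}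
    (hf : ContDiffOn ℝ ∞ (Function.uncurry f) W) {x : E} {t : ℝ} (hxt : (x, t) ∈ W) :
    HasFDerivAt (f · t)
      (fderiv ℝ (Function.uncurry f) (x, t) ∘L ContinuousLinearMap.inl ℝ E ℝ) x := by
  have h := ((hf.contDiffAt (hW.mem_nhds hxt)).differentiableAt (by simp)).hasFDerivAt
  exact HasFDerivAt.comp (g := Function.uncurry f) (f := fun z => (z, t)) x h
    (hasFDerivAt_prodMk_left x t)

theorem contDiffOn_fderiv_left {E G : Type*} [NormedAddCommGroup E] [NormedSpace ℝ E]
    [NormedAddCommGroup G] [NormedSpace ℝ G] {W : Set (E × ℝ)} (hW : IsOpen W) {f : E → ℝ → G}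
    (hf : ContDiffOn ℝ ∞ (Function.uncurry f) W) :
    ContDiffOn ℝ ∞ (Function.uncurry fun x t => fderiv ℝ (f · t) x) W :=
  ((hf.fderiv_of_isOpen hW (m := ∞) (by simp)).clm_comp contDiffOn_const).congr fun _ hp =>
    (hasFDerivAt_left_of_contDiffOn hW hf hp).fderiv

theorem hasFDerivAt_intervalIntegral_of_contDiffOn {E G : Type*} [NormedAddCommGroup E]
    [NormedSpace ℝ E] [NormedAddCommGroup G] [NormedSpace ℝ G] {W : Set (E × ℝ)} (hW : IsOpen W)
    {f : E → ℝ → G} (hf : ContDiffOn ℝ ∞ (Function.uncurry f) W) {a b : ℝ} {y : E}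
    (hy : ∀ t ∈ uIcc a b, (y, t) ∈ W) :
    HasFDerivAt (fun x => ∫ t in a..b, f x t) (∫ t in a..b, fderiv ℝ (f · t) y) y :=
  hasFDerivAt_intervalIntegral_of_continuousOn (f' := fun x t => fderiv ℝ (f · t) x) hW
    hf.continuousOn (contDiffOn_fderiv_left hW hf).continuousOn
    (fun _ _ hxt => (hasFDerivAt_left_of_contDiffOn hW hf hxt).differentiableAt.hasFDerivAt) hy

theorem contDiffOn_intervalIntegral {E : Type u} [NormedAddCommGroup E] [NormedSpace ℝ E]
    {G : Type (max u v)} [NormedAddCommGroup G] [NormedSpace ℝ G] {W : Set (E × ℝ)}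
    (hW : IsOpen W) {f : E → ℝ → G} (hf : ContDiffOn ℝ ∞ (Function.uncurry f) W) {a b : ℝ}
    {s : Set E} (hs : IsOpen s) (hsW : s ×ˢ uIcc a b ⊆ W) :
    ContDiffOn ℝ ∞ (fun x => ∫ t in a..b, f x t) s := by
  refine contDiffOn_infty.2 fun n => ?_
  induction n generalizing G with
  | zero =>
    exact contDiffOn_zero.2 fun x hx => (hasFDerivAt_intervalIntegral_of_contDiffOn hW hf
      fun t ht => hsW ⟨hx, ht⟩).continuousAt.continuousWithinAt
  | succ n ih =>
    have hderiv := fun x hx => hasFDerivAt_intervalIntegral_of_contDiffOn (a := a) (b := b)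
      (y := x) hW hf fun t ht => hsW ⟨hx, ht⟩
    rw [Nat.cast_add, Nat.cast_one, contDiffOn_succ_iff_fderiv_of_isOpen hs]
    exact ⟨fun x hx => (hderiv x hx).differentiableAt.differentiableWithinAt, by simp,
      (ih (contDiffOn_fderiv_left hW hf)).congr fun x hx => (hderiv x hx).fderiv⟩

end ParametricIntegral

section RadialHomotopy

variable {E : Type u} [NormedAddCommGroup E] [NormedSpace ℝ E] {F : Type v}
  [NormedAddCommGroup F] [NormedSpace ℝ F] {q : ℕ}

/-- The interior product `α ↦ α(w, ·, …, ·)` of alternating forms with vectors `w`, as a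
continuous bilinear map. -/
def interiorProduct : E →L[ℝ] E [⋀^Fin (q + 1)]→L[ℝ] F →L[ℝ] E [⋀^Fin q]→L[ℝ] F :=
  (ContinuousAlternatingMap.curryLeftLI (𝕜 := ℝ)).toContinuousLinearMap.flip

theorem interiorProduct_apply (w : E) (α : E [⋀^Fin (q + 1)]→L[ℝ] F) :
    interiorProduct w α = α.curryLeft w :=
  rfl

theorem alternatizeUncurryFin_interiorProduct_comp (w : E)
    (L : E →L[ℝ] E [⋀^Fin (q + 1)]→L[ℝ] F) :
    ContinuousAlternatingMap.alternatizeUncurryFin (interiorProduct w ∘L L) =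
      L w - interiorProduct w (ContinuousAlternatingMap.alternatizeUncurryFin L) := by
  ext v
  rw [ContinuousAlternatingMap.alternatizeUncurryFin_apply, ContinuousAlternatingMap.sub_apply,
    interiorProduct_apply, ContinuousAlternatingMap.curryLeft_apply_apply,
    ContinuousAlternatingMap.alternatizeUncurryFin_apply, Fin.sum_univ_succ (n := q + 1)]
  have hsucc (i : Fin (q + 1)) :
      i.succ.removeNth (Matrix.vecCons w v) = Matrix.vecCons w (i.removeNth v) := by
    ext j
    cases j using Fin.cases <;> simp [Fin.removeNth]
  have hzero : Fin.removeNth 0 (Matrix.vecCons w v) = v := rfl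
  simp only [Fin.val_zero, pow_zero, one_smul, Matrix.cons_val_zero, Fin.val_succ, pow_succ,
    Matrix.cons_val_succ, mul_neg, mul_one, neg_smul, Finset.sum_neg_distrib, hzero, hsucc,
    sub_add_cancel_left, neg_neg]
  rfl

/-- The homotopy operator of the Poincaré lemma, for the contraction of `E` to `a` along rays. -/
def radialHomotopy (a : E) (α : E → E [⋀^Fin (q + 1)]→L[ℝ] F) (y : E) : E [⋀^Fin q]→L[ℝ] F :=
  ∫ t in (0 : ℝ)..1, t ^ q • interiorProduct (y - a) (α (a + t • (y - a)))

theorem contDiffOn_radialHomotopy_integrand {a : E} {s : Set E}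
    {α : E → E [⋀^Fin (q + 1)]→L[ℝ] F} (hα : ContDiffOn ℝ ∞ α s) :
    ContDiffOn ℝ ∞ (Function.uncurry fun (y : E) (t : ℝ) =>
        t ^ q • interiorProduct (y - a) (α (a + t • (y - a))))
      {p : E × ℝ | a + p.2 • (p.1 - a) ∈ s} := by
  have hray : ContDiff ℝ ∞ fun p : E × ℝ => a + p.2 • (p.1 - a) := by fun_prop
  have hproduct : ContDiff ℝ ∞ fun w : E => (interiorProduct w :
      E [⋀^Fin (q + 1)]→L[ℝ] F →L[ℝ] E [⋀^Fin q]→L[ℝ] F) := by fun_prop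
  have hvector : ContDiff ℝ ∞ fun p : E × ℝ => p.1 - a := by fun_prop
  exact (contDiff_snd.pow q).contDiffOn.smul
    ((hproduct.comp hvector).contDiffOn.clm_apply (hα.comp hray.contDiffOn fun _ hp => hp))

theorem isOpen_setOf_ray_mem {s : Set E} (hs : IsOpen s) (a : E) :
    IsOpen {p : E × ℝ | a + p.2 • (p.1 - a) ∈ s} :=
  hs.preimage (by fun_prop)

theorem ray_mem_of_starConvex {s : Set E} {a y : E} (hs : StarConvex ℝ a s) (hy : y ∈ s)
    {t : ℝ} (ht : t ∈ Set.uIcc (0 : ℝ) 1) : a + t • (y - a) ∈ s := by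
  rw [Set.uIcc_of_le zero_le_one] at ht
  exact hs.add_smul_sub_mem hy ht.1 ht.2

theorem contDiffOn_radialHomotopy {a : E} {s : Set E} (hs : IsOpen s) (hsa : StarConvex ℝ a s)
    {α : E → E [⋀^Fin (q + 1)]→L[ℝ] F} (hα : ContDiffOn ℝ ∞ α s) :
    ContDiffOn ℝ ∞ (radialHomotopy a α) s :=
  contDiffOn_intervalIntegral.{u, v} (isOpen_setOf_ray_mem hs a)
    (contDiffOn_radialHomotopy_integrand hα) hs fun _ hp => ray_mem_of_starConvex hsa hp.1 hp.2

theorem hasFDerivAt_radialHomotopy_integrand {a y : E} {α : E → E [⋀^Fin (q + 1)]→L[ℝ] F} {t : ℝ}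
    (hα : DifferentiableAt ℝ α (a + t • (y - a))) :
    HasFDerivAt (fun y => t ^ q • interiorProduct (y - a) (α (a + t • (y - a))))
      (t ^ q • (t • interiorProduct (y - a) ∘L fderiv ℝ α (a + t • (y - a)) +
        (α (a + t • (y - a))).curryLeft)) y := by
  have hray : HasFDerivAt (fun z : E => a + t • (z - a)) (t • ContinuousLinearMap.id ℝ E) y :=
    (((hasFDerivAt_id y).sub_const a).const_smul t).const_add a
  have hbilin := interiorProduct.hasFDerivAt_of_bilinear ((hasFDerivAt_id y).sub_const a)
    (hα.hasFDerivAt.comp y hray)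
  refine (hbilin.const_smul (t ^ q)).congr_fderiv ?_
  ext v
  simp [interiorProduct_apply]

theorem hasDerivAt_pow_smul_ray {a w : E} {G : Type*} [NormedAddCommGroup G] [NormedSpace ℝ G]
    {α : E → G} {t : ℝ} (hα : DifferentiableAt ℝ α (a + t • w)) :
    HasDerivAt (fun t : ℝ => t ^ (q + 1) • α (a + t • w))
      (t ^ q • (t • fderiv ℝ α (a + t • w) w + ((q : ℝ) + 1) • α (a + t • w))) t := by
  have hray : HasDerivAt (fun t : ℝ => a + t • w) w t := by
    simpa using ((hasDerivAt_id t).smul_const w).const_add a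
  refine ((hasDerivAt_pow (q + 1) t).smul
    (hα.hasFDerivAt.comp_hasDerivAt t hray)).congr_deriv ?_
  simp only [Nat.add_sub_cancel, Nat.cast_add, Nat.cast_one, smul_add, smul_smul, pow_succ,
    mul_comm]
  rfl

theorem extDeriv_radialHomotopy_integrand {a y : E} {α : E → E [⋀^Fin (q + 1)]→L[ℝ] F} {t : ℝ}
    (hα : DifferentiableAt ℝ α (a + t • (y - a))) :
    extDeriv (fun y => t ^ q • interiorProduct (y - a) (α (a + t • (y - a)))) y +
        t ^ (q + 1) • interiorProduct (y - a) (extDeriv α (a + t • (y - a))) =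
      t ^ q • (t • fderiv ℝ α (a + t • (y - a)) (y - a) +
        ((q : ℝ) + 1) • α (a + t • (y - a))) := by
  have hcurry : ContinuousAlternatingMap.alternatizeUncurryFin (α (a + t • (y - a))).curryLeft =
      ((q : ℝ) + 1) • α (a + t • (y - a)) := by
    rw [ContinuousAlternatingMap.alternatizeUncurryFin_curryLeft, ← Nat.cast_smul_eq_nsmul ℝ,
      Nat.cast_add_one]
  rw [extDeriv, (hasFDerivAt_radialHomotopy_integrand hα).fderiv,
    ContinuousAlternatingMap.alternatizeUncurryFin_smul,
    ContinuousAlternatingMap.alternatizeUncurryFin_add,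
    ContinuousAlternatingMap.alternatizeUncurryFin_smul,
    alternatizeUncurryFin_interiorProduct_comp, hcurry, ← extDeriv]
  module

theorem continuousOn_extDeriv_left {W : Set (E × ℝ)} (hW : IsOpen W)
    {α : E → ℝ → E [⋀^Fin q]→L[ℝ] F} (hα : ContDiffOn ℝ ∞ (Function.uncurry α) W) :
    ContinuousOn (Function.uncurry fun x t => extDeriv (α · t) x) W :=
  (ContinuousAlternatingMap.alternatizeUncurryFinCLM ℝ E F).continuous.comp_continuousOn
    (contDiffOn_fderiv_left hW hα).continuousOn

theorem extDeriv_intervalIntegral [CompleteSpace F] {W : Set (E × ℝ)} (hW : IsOpen W)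
    {α : E → ℝ → E [⋀^Fin q]→L[ℝ] F} (hα : ContDiffOn ℝ ∞ (Function.uncurry α) W) {a b : ℝ} {y : E}
    (hy : ∀ t ∈ Set.uIcc a b, (y, t) ∈ W) :
    extDeriv (fun x => ∫ t in a..b, α x t) y = ∫ t in a..b, extDeriv (α · t) y := by
  have hcont := (contDiffOn_fderiv_left hW hα).continuousOn.comp
    (Continuous.prodMk_right y).continuousOn hy
  rw [extDeriv, (hasFDerivAt_intervalIntegral_of_contDiffOn hW hα hy).fderiv]
  exact ((ContinuousAlternatingMap.alternatizeUncurryFinCLM ℝ E F).intervalIntegral_comp_comm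
    (μ := MeasureTheory.volume) hcont.intervalIntegrable).symm

theorem continuousOn_extDeriv {s : Set E} (hs : IsOpen s) {α : E → E [⋀^Fin q]→L[ℝ] F}
    (hα : ContDiffOn ℝ ∞ α s) : ContinuousOn (extDeriv α) s :=
  (ContinuousAlternatingMap.alternatizeUncurryFinCLM ℝ E F).continuous.comp_continuousOn
    (hα.fderiv_of_isOpen hs (m := ∞) (by simp)).continuousOn

theorem extDeriv_radialHomotopy_add [CompleteSpace F] {a y : E} {s : Set E} (hs : IsOpen s)
    (hsa : StarConvex ℝ a s) {α : E → E [⋀^Fin (q + 1)]→L[ℝ] F} (hα : ContDiffOn ℝ ∞ α s)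
    (hy : y ∈ s) :
    extDeriv (radialHomotopy a α) y + radialHomotopy a (extDeriv α) y = α y := by
  have hray (t : ℝ) (ht : t ∈ Set.uIcc (0 : ℝ) 1) : a + t • (y - a) ∈ s :=
    ray_mem_of_starConvex hsa hy ht
  have hdiff (t : ℝ) (ht : t ∈ Set.uIcc (0 : ℝ) 1) : DifferentiableAt ℝ α (a + t • (y - a)) :=
    (hα.contDiffAt (hs.mem_nhds (hray t ht))).differentiableAt (by simp)
  have hW := isOpen_setOf_ray_mem hs a
  have hsmooth := contDiffOn_radialHomotopy_integrand hα (a := a)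
  have hcont₁ : ContinuousOn (fun t : ℝ =>
      extDeriv (fun x => t ^ q • interiorProduct (x - a) (α (a + t • (x - a)))) y) (Set.uIcc 0 1) :=
    (continuousOn_extDeriv_left hW hsmooth).comp (Continuous.prodMk_right y).continuousOn hray
  have hcont₂ : ContinuousOn
      (fun t : ℝ => t ^ (q + 1) • interiorProduct (y - a) (extDeriv α (a + t • (y - a))))
      (Set.uIcc 0 1) :=
    (continuous_pow (q + 1)).continuousOn.smul <|
      (interiorProduct (y - a)).continuous.comp_continuousOn <|
        (continuousOn_extDeriv hs hα).comp (by fun_prop) hray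
  have hderiv (t : ℝ) (ht : t ∈ Set.uIcc (0 : ℝ) 1) :=
    (hasDerivAt_pow_smul_ray (q := q) (hdiff t ht)).congr_deriv
      (extDeriv_radialHomotopy_integrand (hdiff t ht)).symm
  have hFTC := intervalIntegral.integral_eq_sub_of_hasDerivAt hderiv
    (hcont₁.add hcont₂).intervalIntegrable
  rw [intervalIntegral.integral_add hcont₁.intervalIntegrable hcont₂.intervalIntegrable] at hFTC
  unfold radialHomotopy
  rw [extDeriv_intervalIntegral hW hsmooth hray, hFTC]
  simp

theorem exists_extDeriv_eq_of_starConvex [CompleteSpace F] {a : E} {s : Set E} (hs : IsOpen s)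
    (hsa : StarConvex ℝ a s) {α : E → E [⋀^Fin (q + 1)]→L[ℝ] F} (hα : ContDiffOn ℝ ∞ α s)
    (hd : ∀ y ∈ s, extDeriv α y = 0) :
    ∃ η : E → E [⋀^Fin q]→L[ℝ] F, ContDiffOn ℝ ∞ η s ∧ ∀ y ∈ s, extDeriv η y = α y := by
  refine ⟨radialHomotopy a α, contDiffOn_radialHomotopy hs hsa hα, fun y hy => ?_⟩
  have hzero : radialHomotopy a (extDeriv α) y = 0 :=
    intervalIntegral.integral_zero_ae (.of_forall fun t ht => by
      rw [hd _ (ray_mem_of_starConvex hsa hy (Set.uIoc_subset_uIcc ht)), map_zero, smul_zero])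
  rw [← extDeriv_radialHomotopy_add hs hsa hα hy, hzero, add_zero]

theorem eq_of_extDeriv_eq_zero {s : Set E} (hs : IsOpen s) (hs' : IsPreconnected s)
    {α : E → E [⋀^Fin 0]→L[ℝ] F} (hα : DifferentiableOn ℝ α s) (hd : ∀ y ∈ s, extDeriv α y = 0)
    {y z : E} (hy : y ∈ s) (hz : z ∈ s) : α y = α z := by
  refine hs.is_const_of_fderiv_eq_zero hs' hα (fun x hx => ?_) hy hz
  ext u v
  have h := DFunLike.congr_fun (hd x hx) fun _ => u
  rw [extDeriv, ContinuousAlternatingMap.alternatizeUncurryFin_apply] at h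
  simpa [Subsingleton.elim v (Fin.removeNth 0 fun _ => u)] using h

end RadialHomotopy

/-! ### Smooth forms and the exterior derivative -/

section Pullback

open ContinuousAlternatingMap ContinuousLinearMap

set_option maxSynthPendingDepth 3

variable {𝕜 : Type*} [NontriviallyNormedField 𝕜] [CharZero 𝕜] {E F G : Type*}
  [NormedAddCommGroup E] [NormedSpace 𝕜 E] [NormedAddCommGroup F] [NormedSpace 𝕜 F]
  [NormedAddCommGroup G] [NormedSpace 𝕜 G]

theorem compContinuousLinearMap_eq_inv_smul {k : ℕ} (g : E →L[𝕜] F)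
    (f : F [⋀^Fin (k + 1)]→L[𝕜] G) :
    f.compContinuousLinearMap g = ((k + 1 : ℕ) : 𝕜)⁻¹ • alternatizeUncurryFin
      (compContinuousLinearMapCLM g ∘L f.curryLeft ∘L g) := by
  have hcurry : (f.compContinuousLinearMap g).curryLeft =
      compContinuousLinearMapCLM g ∘L f.curryLeft ∘L g :=
    ContinuousLinearMap.ext fun x => f.curryLeft_compContinuousLinearMap g x
  rw [← hcurry, alternatizeUncurryFin_curryLeft, ← Nat.cast_smul_eq_nsmul 𝕜,
    inv_smul_smul₀ (Nat.cast_ne_zero.2 k.succ_ne_zero)]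

theorem contDiff_compContinuousLinearMapCLM (n : ℕ∞ω) (k : ℕ) :
    ContDiff 𝕜 n fun g : E →L[𝕜] F =>
      (compContinuousLinearMapCLM g : F [⋀^Fin k]→L[𝕜] G →L[𝕜] E [⋀^Fin k]→L[𝕜] G) := by
  induction k with
  | zero =>
    have hconst (g : E →L[𝕜] F) : (compContinuousLinearMapCLM g :
        F [⋀^Fin 0]→L[𝕜] G →L[𝕜] E [⋀^Fin 0]→L[𝕜] G) = compContinuousLinearMapCLM 0 :=
      ContinuousLinearMap.ext fun f => ContinuousAlternatingMap.ext fun v =>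
        congrArg f (Subsingleton.elim _ _)
    simpa only [hconst] using contDiff_const
  | succ k ih =>
    let curry : F [⋀^Fin (k + 1)]→L[𝕜] G →L[𝕜] F →L[𝕜] F [⋀^Fin k]→L[𝕜] G :=
      (curryLeftLI (𝕜 := 𝕜)).toContinuousLinearMap
    have hcurry : ContDiff 𝕜 n fun g : E →L[𝕜] F =>
        (compL 𝕜 E F (F [⋀^Fin k]→L[𝕜] G)).flip g ∘L curry := by fun_prop
    have hcomp : ContDiff 𝕜 n fun g : E →L[𝕜] F =>
        compL 𝕜 E (F [⋀^Fin k]→L[𝕜] G) (E [⋀^Fin k]→L[𝕜] G) (compContinuousLinearMapCLM g) := by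
      fun_prop
    have halt := (contDiff_const (c := alternatizeUncurryFinCLM 𝕜 E G)).clm_comp
      (hcomp.clm_comp hcurry) |>.const_smul ((k + 1 : ℕ) : 𝕜)⁻¹
    convert halt using 2 with g
    exact ContinuousLinearMap.ext (compContinuousLinearMap_eq_inv_smul g)

theorem contDiffOn_compContinuousLinearMap {n : ℕ∞ω} {k : ℕ} {H : Type*}
    [NormedAddCommGroup H] [NormedSpace 𝕜 H] {s : Set H} {f : H → F [⋀^Fin k]→L[𝕜] G}
    {g : H → E →L[𝕜] F} (hf : ContDiffOn 𝕜 n f s) (hg : ContDiffOn 𝕜 n g s) :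
    ContDiffOn 𝕜 n (fun z => (f z).compContinuousLinearMap (g z)) s :=
  ((contDiff_compContinuousLinearMapCLM (G := G) n k).comp_contDiffOn hg).clm_apply hf

end Pullback

section SmoothForms

variable {E : Type*} [NormedAddCommGroup E] [NormedSpace ℝ E]
  {M : Type*} [TopologicalSpace M] [ChartedSpace E M] {k : ℕ}

/-- The form `θ` is smooth near `x`. -/
def IsSmoothAt (θ : RawForm E M k) (x : M) : Prop :=
  ∀ᶠ U in (𝓝 x).smallSets, IsSmoothOn U θ

theorem isSmoothAt_iff_exists_isOpen {θ : RawForm E M k} {x : M} :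
    IsSmoothAt θ x ↔ ∃ U, IsOpen U ∧ x ∈ U ∧ IsSmoothOn U θ := by
  rw [IsSmoothAt, Filter.eventually_smallSets' fun _ _ h hθ => hθ.mono h]
  constructor
  · rintro ⟨V, hV, hθ⟩
    obtain ⟨U, hUV, hU, hxU⟩ := mem_nhds_iff.1 hV
    exact ⟨U, hU, hxU, hθ.mono hUV⟩
  · rintro ⟨U, hU, hxU, hθ⟩
    exact ⟨U, hU.mem_nhds hxU, hθ⟩

theorem IsSmoothOn.isSmoothAt {U : Set M} (hU : IsOpen U) {θ : RawForm E M k}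
    (hθ : IsSmoothOn U θ) {x : M} (hx : x ∈ U) : IsSmoothAt θ x :=
  isSmoothAt_iff_exists_isOpen.2 ⟨U, hU, hx, hθ⟩

theorem isSmoothOn_of_forall_isSmoothAt {U : Set M} {θ : RawForm E M k}
    (h : ∀ x ∈ U, IsSmoothAt θ x) : IsSmoothOn U θ := fun φ hφ y hy => by
  obtain ⟨V, hV, hyV, hθ⟩ := isSmoothAt_iff_exists_isOpen.1 (h _ hy.2)
  exact (hθ.contDiffAt hV hφ hy.1 hyV).contDiffWithinAt

theorem isSmoothAt_zero (x : M) : IsSmoothAt (0 : RawForm E M k) x :=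
  .of_forall fun U => .zero U

theorem IsSmoothAt.add {θ η : RawForm E M k} {x : M} (hθ : IsSmoothAt θ x)
    (hη : IsSmoothAt η x) : IsSmoothAt (θ + η) x :=
  (hθ.and hη).mono fun _ h => h.1.add h.2

theorem IsSmoothAt.smul {θ : RawForm E M k} {x : M} (r : ℝ) (hθ : IsSmoothAt θ x) :
    IsSmoothAt (r • θ) x :=
  hθ.mono fun _ h => h.smul r

theorem IsSmoothAt.sum {ι : Type*} {s : Finset ι} {θ : ι → RawForm E M k} {x : M}
    (hθ : ∀ i ∈ s, IsSmoothAt (θ i) x) : IsSmoothAt (∑ i ∈ s, θ i) x :=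
  Finset.sum_induction _ (IsSmoothAt · x) (fun _ _ => IsSmoothAt.add) (isSmoothAt_zero x) hθ

theorem inChart_eventuallyEq {θ η : RawForm E M k} {x : M} (h : ∀ᶠ y in 𝓝 x, θ y = η y)
    {φ : OpenPartialHomeomorph M E} (hφ : x ∈ φ.source) :
    inChart φ θ =ᶠ[𝓝 (φ x)] inChart φ η := by
  have hφx := φ.continuousAt_symm (φ.map_source hφ)
  rw [ContinuousAt, φ.left_inv hφ] at hφx
  filter_upwards [hφx.eventually h] with y hy
  rw [inChart, inChart, hy]

theorem IsSmoothAt.congr {θ η : RawForm E M k} {x : M} (hθ : IsSmoothAt θ x)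
    (h : ∀ᶠ y in 𝓝 x, η y = θ y) : IsSmoothAt η x := by
  filter_upwards [hθ, Filter.eventually_smallSets_forall.2 h] with U hU hηθ φ hφ
  exact (hU φ hφ).congr fun y hy => by rw [inChart, inChart, hηθ _ hy.2]

theorem d_eq_of_eventuallyEq {θ η : RawForm E M k} {x : M} (h : ∀ᶠ y in 𝓝 x, θ y = η y) :
    d θ x = d η x := by
  rw [d, d, (inChart_eventuallyEq h (mem_chart_source E x)).extDeriv_eq]

theorem IsSmoothAt.d_add {θ η : RawForm E M k} {x : M} (hθ : IsSmoothAt θ x)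
    (hη : IsSmoothAt η x) : DiffForm.d (θ + η) x = DiffForm.d θ x + DiffForm.d η x := by
  obtain ⟨U, hU, hxU, h⟩ := isSmoothAt_iff_exists_isOpen.1 hθ
  obtain ⟨V, hV, hxV, h'⟩ := isSmoothAt_iff_exists_isOpen.1 hη
  exact DiffForm.d_add (hU.inter hV) (h.mono Set.inter_subset_left)
    (h'.mono Set.inter_subset_right) ⟨hxU, hxV⟩

theorem IsSmoothAt.d_sum {ι : Type*} {s : Finset ι} {θ : ι → RawForm E M k} {x : M}
    (hθ : ∀ i ∈ s, IsSmoothAt (θ i) x) :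
    DiffForm.d (∑ i ∈ s, θ i) x = ∑ i ∈ s, DiffForm.d (θ i) x := by
  classical
  induction s using Finset.induction_on with
  | empty => simp only [Finset.sum_empty, d_zero, zero_apply]
  | insert a s ha ih =>
    rw [Finset.forall_mem_insert] at hθ
    rw [Finset.sum_insert ha, Finset.sum_insert ha, hθ.1.d_add (.sum hθ.2), ih hθ.2]

/-- Multiplication of a form by a function. -/
def fsmul (ρ : M → ℝ) (θ : RawForm E M k) : RawForm E M k := fun x => ρ x • θ x

variable [IsManifold 𝓘(ℝ, E) ∞ M]

theorem IsSmoothAt.d {θ : RawForm E M k} {x : M} (hθ : IsSmoothAt θ x) : IsSmoothAt (d θ) x := by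
  obtain ⟨U, hU, hxU, h⟩ := isSmoothAt_iff_exists_isOpen.1 hθ
  exact (h.d hU).isSmoothAt hU hxU

theorem IsSmoothAt.d_d {θ : RawForm E M k} {x : M} (hθ : IsSmoothAt θ x) :
    DiffForm.d (DiffForm.d θ) x = 0 := by
  obtain ⟨U, hU, hxU, h⟩ := isSmoothAt_iff_exists_isOpen.1 hθ
  exact DiffForm.d_d hU h hxU

theorem IsSmoothAt.fsmul {ρ : M → ℝ} {θ : RawForm E M k} {x : M}
    (hρ : ∀ᶠ y in 𝓝 x, ContMDiffAt 𝓘(ℝ, E) 𝓘(ℝ, ℝ) ∞ ρ y) (hθ : IsSmoothAt θ x) :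
    IsSmoothAt (fsmul ρ θ) x := by
  filter_upwards [Filter.eventually_smallSets_forall.2 hρ, hθ] with U hρU hθU φ hφ
  have hρφ : ContDiffOn ℝ ∞ (fun y => ρ (φ.symm y)) (φ.target ∩ φ.symm ⁻¹' U) := fun y hy =>
    ((hρU _ hy.2).comp y (contMDiffAt_symm_of_mem_maximalAtlas (n := ∞)
      (IsManifold.subset_maximalAtlas hφ) hy.1)).contDiffAt.contDiffWithinAt
  exact (hρφ.smul (hθU φ hφ)).congr fun y _ => rfl

theorem contDiffOn_transition {φ ψ : OpenPartialHomeomorph M E}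
    (hφ : φ ∈ atlas E M) (hψ : ψ ∈ atlas E M) :
    ContDiffOn ℝ ∞ (ψ ∘ φ.symm) (φ.target ∩ φ.symm ⁻¹' ψ.source) := fun _ hy =>
  ((contMDiffAt_of_mem_maximalAtlas (I := 𝓘(ℝ, E)) (n := ∞)
      (IsManifold.subset_maximalAtlas hψ) hy.2).comp _
    (contMDiffAt_symm_of_mem_maximalAtlas (n := ∞)
      (IsManifold.subset_maximalAtlas hφ) hy.1)).contDiffAt.contDiffWithinAt

theorem isSmoothOn_of_contDiffOn_inChart {V : Set M} (hV : IsOpen V)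
    {φ : OpenPartialHomeomorph M E} (hφ : φ ∈ atlas E M) (hVφ : V ⊆ φ.source)
    {θ : RawForm E M k} (hθ : ContDiffOn ℝ ∞ (inChart φ θ) (φ.target ∩ φ.symm ⁻¹' V)) :
    IsSmoothOn V θ := by
  intro ψ hψ
  have htransition : ContDiffOn ℝ ∞ (φ ∘ ψ.symm) (ψ.target ∩ ψ.symm ⁻¹' V) :=
    (contDiffOn_transition hψ hφ).mono fun z hz => ⟨hz.1, hVφ hz.2⟩
  have hpull := hθ.comp htransition fun z hz => ⟨φ.map_source (hVφ hz.2), by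
    simpa [φ.left_inv (hVφ hz.2)] using hz.2⟩
  have hfderiv := htransition.fderiv_of_isOpen (ψ.isOpen_inter_preimage_symm hV) (m := ∞) (by simp)
  exact (contDiffOn_compContinuousLinearMap hpull hfderiv).congr fun z hz =>
    inChart_eq θ hψ hφ hz.1 (hVφ hz.2)

/-- The form on `M` (meaningful on `φ.source`) with a given expression in the chart `φ`. -/
def ofChart (φ : OpenPartialHomeomorph M E) (α : E → E [⋀^Fin k]→L[ℝ] ℝ) : RawForm E M k :=
  fun x => (α (φ x)).compContinuousLinearMap
    (mfderiv 𝓘(ℝ, E) 𝓘(ℝ, E) φ x : TangentSpace 𝓘(ℝ, E) x →L[ℝ] E)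

theorem inChart_ofChart {φ : OpenPartialHomeomorph M E} (hφ : φ ∈ atlas E M)
    (α : E → E [⋀^Fin k]→L[ℝ] ℝ) {y : E} (hy : y ∈ φ.target) : inChart φ (ofChart φ α) y = α y := by
  have hid : ((mfderiv 𝓘(ℝ, E) 𝓘(ℝ, E) φ (φ.symm y) : E →L[ℝ] E).comp
        (mfderiv 𝓘(ℝ, E) 𝓘(ℝ, E) φ.symm y : E →L[ℝ] E)) = ContinuousLinearMap.id ℝ E := by
    have hcomp := mfderiv_comp y (mdiff_chart hφ (φ.map_target hy)) (mdiff_chart_symm hφ hy)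
    have hcancel : φ ∘ φ.symm =ᶠ[𝓝 y] id := by
      filter_upwards [φ.open_target.mem_nhds hy] with z hz using φ.right_inv hz
    rw [hcancel.mfderiv_eq, mfderiv_id] at hcomp
    exact hcomp.symm
  change (α (φ (φ.symm y))).compContinuousLinearMap
    ((mfderiv 𝓘(ℝ, E) 𝓘(ℝ, E) φ (φ.symm y) : E →L[ℝ] E).comp
        (mfderiv 𝓘(ℝ, E) 𝓘(ℝ, E) φ.symm y : E →L[ℝ] E)) = α y
  rw [hid, φ.right_inv hy]
  ext v
  rfl

theorem eq_of_inChart_eq {φ : OpenPartialHomeomorph M E} (hφ : φ ∈ atlas E M)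
    {θ η : RawForm E M k} {x : M} (hx : x ∈ φ.source)
    (h : inChart φ θ (φ x) = inChart φ η (φ x)) : θ x = η x := by
  have hid : ((mfderiv 𝓘(ℝ, E) 𝓘(ℝ, E) φ.symm (φ x) : E →L[ℝ] E).comp
        (mfderiv 𝓘(ℝ, E) 𝓘(ℝ, E) φ x : E →L[ℝ] E)) = ContinuousLinearMap.id ℝ E := by
    have hcomp := mfderiv_comp x (mdiff_chart_symm hφ (φ.map_source hx)) (mdiff_chart hφ hx)
    have hcancel : φ.symm ∘ φ =ᶠ[𝓝 x] id := by
      filter_upwards [φ.open_source.mem_nhds hx] with z hz using φ.left_inv hz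
    rw [hcancel.mfderiv_eq, mfderiv_id] at hcomp
    exact hcomp.symm
  have key : ∀ ζ : RawForm E M k, (inChart φ ζ (φ x)).compContinuousLinearMap
      (mfderiv 𝓘(ℝ, E) 𝓘(ℝ, E) φ x : E →L[ℝ] E) = ζ x := by
    intro ζ
    let ζ' : M → E [⋀^Fin k]→L[ℝ] ℝ := ζ
    change (ζ' (φ.symm (φ x))).compContinuousLinearMap
      ((mfderiv 𝓘(ℝ, E) 𝓘(ℝ, E) φ.symm (φ x) : E →L[ℝ] E).comp
        (mfderiv 𝓘(ℝ, E) 𝓘(ℝ, E) φ x : E →L[ℝ] E)) = ζ' x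
    rw [hid, φ.left_inv hx]
    ext v
    rfl
  rw [← key θ, ← key η, h]

end SmoothForms

/-! ### Local primitives and partitions of unity -/

section LocalPrimitives

variable {E : Type*} [NormedAddCommGroup E] [NormedSpace ℝ E]
  {M : Type*} [TopologicalSpace M] [ChartedSpace E M] {k : ℕ}

/-- The constant `0`-form. -/
def constForm (r : ℝ) : RawForm E M 0 := fun x =>
  ContinuousAlternatingMap.constOfIsEmpty ℝ (TangentSpace 𝓘(ℝ, E) x) (Fin 0) r

/-- The function underlying a `0`-form. -/
def toFun (θ : RawForm E M 0) (x : M) : ℝ := θ x fun i => i.elim0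

theorem constForm_toFun (θ : RawForm E M 0) (x : M) :
    (constForm (toFun θ x) : RawForm E M 0) x = θ x :=
  ContinuousAlternatingMap.ext fun _ => congrArg (θ x) (Subsingleton.elim _ _)

theorem constForm_apply_eq_zero_iff {r : ℝ} {x : M} :
    (constForm r : RawForm E M 0) x = 0 ↔ r = 0 :=
  ⟨fun h => congrArg (fun ξ => ξ fun i => i.elim0) h, fun h => h ▸ rfl⟩

theorem isSmoothAt_constForm (r : ℝ) (x : M) : IsSmoothAt (constForm r : RawForm E M 0) x :=
  .of_forall fun _ _ _ =>
    contDiffOn_const (c := ContinuousAlternatingMap.constOfIsEmpty ℝ E (Fin 0) r)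

theorem d_constForm (r : ℝ) : d (constForm r : RawForm E M 0) = 0 := by
  funext x
  have h : extDeriv (inChart (chartAt E x) (constForm r : RawForm E M 0)) (chartAt E x x) = 0 := by
    change extDeriv (fun _ => ContinuousAlternatingMap.constOfIsEmpty ℝ E (Fin 0) r) _ = 0
    rw [extDeriv, fderiv_fun_const]
    exact map_zero (ContinuousAlternatingMap.alternatizeUncurryFinCLM ℝ E ℝ)
  rw [d, h]
  rfl

theorem inChart_apply_elim0 {φ : OpenPartialHomeomorph M E} {θ : RawForm E M 0} {x : M}
    (hx : x ∈ φ.source) :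
    (inChart φ θ (φ x) fun i => i.elim0) = toFun θ x := by
  have hθ : (inChart φ θ (φ x) fun i => i.elim0) = toFun θ (φ.symm (φ x)) :=
    congrArg (θ (φ.symm (φ x))) (Subsingleton.elim _ _)
  rw [hθ, φ.left_inv hx]

section Poincare

variable (E) in
/-- A set on which the Poincaré lemma holds for smooth forms of every degree. -/
structure IsAcyclic (V : Set M) : Prop where
  exists_d_eq {q : ℕ} {θ : RawForm E M (q + 1)} : IsSmoothOn V θ → (∀ x ∈ V, d θ x = 0) →
    ∃ η : RawForm E M q, IsSmoothOn V η ∧ ∀ x ∈ V, d η x = θ x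
  toFun_eq {θ : RawForm E M 0} : IsSmoothOn V θ → (∀ x ∈ V, d θ x = 0) →
    ∀ x ∈ V, ∀ y ∈ V, toFun θ x = toFun θ y

variable [IsManifold 𝓘(ℝ, E) ∞ M] {φ : OpenPartialHomeomorph M E} {B : Set E}

theorem extDeriv_inChart_eq_zero (hφ : φ ∈ atlas E M) {V : Set M} (hV : IsOpen V)
    {θ : RawForm E M k} (hθ : IsSmoothOn V θ) (hd : ∀ x ∈ V, d θ x = 0) {y : E}
    (hy : y ∈ φ.target) (hyV : φ.symm y ∈ V) : extDeriv (inChart φ θ) y = 0 := by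
  rw [← inChart_d hV hθ hφ hy hyV, inChart, hd _ hyV]
  rfl

theorem exists_d_eq_of_starConvex (hφ : φ ∈ atlas E M) (hB : IsOpen B) (hBφ : B ⊆ φ.target)
    {a : E} (ha : StarConvex ℝ a B) {θ : RawForm E M (k + 1)}
    (hθ : IsSmoothOn (φ.source ∩ φ ⁻¹' B) θ) (hd : ∀ x ∈ φ.source ∩ φ ⁻¹' B, d θ x = 0) :
    ∃ η : RawForm E M k, IsSmoothOn (φ.source ∩ φ ⁻¹' B) η ∧
      ∀ x ∈ φ.source ∩ φ ⁻¹' B, d η x = θ x := by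
  have hV : IsOpen (φ.source ∩ φ ⁻¹' B) := φ.isOpen_inter_preimage hB
  have hsymm : ∀ y ∈ B, φ.symm y ∈ φ.source ∩ φ ⁻¹' B := fun y hy =>
    ⟨φ.map_target (hBφ hy), by rwa [Set.mem_preimage, φ.right_inv (hBφ hy)]⟩
  obtain ⟨α, hα, hαθ⟩ := exists_extDeriv_eq_of_starConvex hB ha
    ((hθ φ hφ).mono fun y hy => ⟨hBφ hy, hsymm y hy⟩)
    fun y hy => extDeriv_inChart_eq_zero hφ hV hθ hd (hBφ hy) (hsymm y hy)
  have hsmooth : IsSmoothOn (φ.source ∩ φ ⁻¹' B) (ofChart φ α : RawForm E M k) :=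
    isSmoothOn_of_contDiffOn_inChart hV hφ Set.inter_subset_left <|
      (hα.mono fun y hy => by simpa only [Set.mem_preimage, φ.right_inv hy.1] using hy.2.2).congr
        fun y (hy : y ∈ φ.target ∩ φ.symm ⁻¹' _) => inChart_ofChart hφ α hy.1
  refine ⟨ofChart φ α, hsmooth, fun x hx => eq_of_inChart_eq hφ hx.1 ?_⟩
  rw [inChart_d hV hsmooth hφ (φ.map_source hx.1) (by rwa [φ.left_inv hx.1]), ← hαθ _ hx.2]
  refine Filter.EventuallyEq.extDeriv_eq ?_
  filter_upwards [φ.open_target.mem_nhds (φ.map_source hx.1)] with y hy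
  exact inChart_ofChart hφ α hy

theorem toFun_eq_of_isPreconnected (hφ : φ ∈ atlas E M) (hB : IsOpen B) (hBφ : B ⊆ φ.target)
    (hB' : IsPreconnected B) {θ : RawForm E M 0} (hθ : IsSmoothOn (φ.source ∩ φ ⁻¹' B) θ)
    (hd : ∀ x ∈ φ.source ∩ φ ⁻¹' B, d θ x = 0) {x y : M} (hx : x ∈ φ.source ∩ φ ⁻¹' B)
    (hy : y ∈ φ.source ∩ φ ⁻¹' B) : toFun θ x = toFun θ y := by
  have hV : IsOpen (φ.source ∩ φ ⁻¹' B) := φ.isOpen_inter_preimage hB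
  have hsymm : ∀ y ∈ B, φ.symm y ∈ φ.source ∩ φ ⁻¹' B := fun y hy =>
    ⟨φ.map_target (hBφ hy), by rwa [Set.mem_preimage, φ.right_inv (hBφ hy)]⟩
  have hdiff : DifferentiableOn ℝ (inChart φ θ) B :=
    ((hθ φ hφ).mono fun y hy => ⟨hBφ hy, hsymm y hy⟩).differentiableOn (by simp)
  rw [← inChart_apply_elim0 hx.1, ← inChart_apply_elim0 hy.1,
    eq_of_extDeriv_eq_zero hB hB' hdiff
      (fun y hy => extDeriv_inChart_eq_zero hφ hV hθ hd (hBφ hy) (hsymm y hy)) hx.2 hy.2]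

theorem exists_isAcyclic {U : Set M} {z : M} (hU : U ∈ 𝓝 z) :
    ∃ V ⊆ U, IsOpen V ∧ z ∈ V ∧ IsAcyclic E V := by
  have hφ := chart_mem_atlas E z
  set φ := chartAt E z
  have hz : z ∈ φ.source := mem_chart_source E z
  have hpre : φ.target ∩ φ.symm ⁻¹' U ∈ 𝓝 (φ z) :=
    Filter.inter_mem (φ.open_target.mem_nhds (φ.map_source hz))
      (φ.continuousAt_symm (φ.map_source hz) (by rwa [φ.left_inv hz]))
  obtain ⟨R, hR, hball⟩ := Metric.mem_nhds_iff.1 hpre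
  have hconvex := convex_ball (φ z) R
  refine ⟨φ.source ∩ φ ⁻¹' Metric.ball (φ z) R, fun x hx => ?_,
    φ.isOpen_inter_preimage Metric.isOpen_ball, ⟨hz, Metric.mem_ball_self hR⟩, ?_, ?_⟩
  · exact φ.left_inv hx.1 ▸ (hball hx.2).2
  · exact fun hθ hd => exists_d_eq_of_starConvex hφ Metric.isOpen_ball (fun y hy => (hball hy).1)
      (hconvex (Metric.mem_ball_self hR)) hθ hd
  · exact fun hθ hd x hx y hy => toFun_eq_of_isPreconnected hφ Metric.isOpen_ball
      (fun y hy => (hball hy).1) hconvex.isPreconnected hθ hd hx hy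

end Poincare

theorem exists_smooth_partition [IsManifold 𝓘(ℝ, E) ∞ M] [FiniteDimensional ℝ E] [T2Space M]
    [SecondCountableTopology M] (U : TopologicalSpace.Opens M) {V : U → Set M}
    (hV : ∀ a : U, V a ∈ 𝓝 (a : M)) :
    ∃ ρ : U → M → ℝ, (∀ a, ∀ x ∈ U, ContMDiffAt 𝓘(ℝ, E) 𝓘(ℝ, ℝ) ∞ (ρ a) x) ∧
      ∀ z ∈ U, ∃ S : Finset U, (∀ a ∈ S, V a ∈ 𝓝 z) ∧
        ∀ᶠ y in 𝓝 z, (∀ a ∉ S, ρ a y = 0) ∧ ∑ a ∈ S, ρ a y = 1 := by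
  have : ProperSpace E := FiniteDimensional.proper ℝ E
  have : LocallyCompactSpace U := ChartedSpace.locallyCompactSpace E U
  obtain ⟨f, hf⟩ := SmoothPartitionOfUnity.exists_isSubordinate 𝓘(ℝ, E) (M := U)
    isClosed_univ (fun a : U => (Subtype.val ⁻¹' interior (V a) : Set U))
    (fun a => isOpen_interior.preimage continuous_subtype_val)
    fun a _ => Set.mem_iUnion.2 ⟨a, mem_interior_iff_mem_nhds.2 (hV a)⟩
  let ρ : U → M → ℝ := fun a => Function.extend Subtype.val (f a) 0
  have hρ : ∀ a y : U, ρ a y = f a y := fun a => Subtype.val_injective.extend_apply _ _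
  refine ⟨ρ, fun a x hx => ?_, fun z hz => ?_⟩
  · have hsmooth : ContMDiffAt 𝓘(ℝ, E) 𝓘(ℝ, ℝ) ∞ (fun y : U => ρ a y) ⟨x, hx⟩ := by
      simpa only [hρ] using (f a).contMDiff _
    exact contMDiffAt_subtype_iff.1 hsmooth
  · refine ⟨f.fintsupport ⟨z, hz⟩, fun a ha =>
      mem_interior_iff_mem_nhds.1 (hf a ((f.mem_fintsupport_iff _ a).1 ha)), ?_⟩
    rw [← U.isOpenEmbedding'.map_nhds_eq ⟨z, hz⟩, Filter.eventually_map]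
    filter_upwards [f.eventually_finsupport_subset ⟨z, hz⟩] with y hy
    simp only [hρ]
    exact ⟨fun a ha => not_not.1 fun hne => ha (hy ((f.mem_finsupport y).2 hne)),
      f.sum_finsupport' y (Set.mem_univ y) hy⟩

end LocalPrimitives

/-! ### Functions of several points near the diagonal -/

section NearDiagonal

variable {X Y : Type*} [TopologicalSpace X] [TopologicalSpace Y] {p : ℕ}

/-- The filter of neighbourhoods of the diagonal of `U` in `X ^ p × X`. A cochain of forms is a
function of `p` points whose values are forms; the last factor is the point of the form. -/
def nearDiagonal (p : ℕ) (U : Opens X) : Filter ((Fin p → X) × X) :=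
  𝓝ˢ ((fun z => (fun _ => z, z)) '' (U : Set X))

theorem eventually_nearDiagonal_iff {U : Opens X} {P : (Fin p → X) × X → Prop} :
    (∀ᶠ w in nearDiagonal p U, P w) ↔
      ∀ z ∈ U, ∃ V ∈ 𝓝 z, ∀ x : Fin p → X, (∀ i, x i ∈ V) → ∀ y ∈ V, P (x, y) := by
  rw [nearDiagonal, eventually_nhdsSet_iff_forall, Set.forall_mem_image]
  refine forall₂_congr fun z _ => ?_
  rw [nhds_prod_eq, nhds_pi, Filter.eventually_prod_iff]
  constructor
  · rintro ⟨pa, hpa, pb, hpb, h⟩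
    obtain ⟨I, -, t, ht, hI⟩ := Filter.mem_pi.1 hpa
    exact ⟨(⋂ i, t i) ∩ {y | pb y}, Filter.inter_mem (Filter.iInter_mem.2 ht) hpb,
      fun x hx y hy => h (hI fun i _ => Set.mem_iInter.1 (hx i).1 i) hy.2⟩
  · rintro ⟨V, hV, h⟩
    exact ⟨fun x => ∀ i, x i ∈ V, Filter.eventually_pi fun _ => hV, (· ∈ V), hV,
      fun hx _ hy => h _ hx _ hy⟩

theorem eventually_snd_nearDiagonal_iff {U : Opens X} {P : X → Prop} :
    (∀ᶠ w in nearDiagonal p U, P w.2) ↔ ∀ x ∈ U, P x := by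
  rw [eventually_nearDiagonal_iff]
  constructor
  · intro h x hx
    obtain ⟨V, hV, hP⟩ := h x hx
    exact hP (fun _ => x) (fun _ => mem_of_mem_nhds hV) x (mem_of_mem_nhds hV)
  · exact fun h z hz => ⟨U, U.isOpen.mem_nhds hz, fun _ _ => h⟩

theorem nearDiagonal_mono {U V : Opens X} (h : U ≤ V) : nearDiagonal p U ≤ nearDiagonal p V :=
  nhdsSet_mono (Set.image_mono h)

theorem eventually_eventually_nearDiagonal {U : Opens X} {P : (Fin p → X) × X → Prop}
    (h : ∀ᶠ w in nearDiagonal p U, P w) :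
    ∀ᶠ w in nearDiagonal p U, ∀ᶠ y in 𝓝 w.2, P (w.1, y) :=
  h.eventually_nhdsSet.mono fun _ hw => hw.curry_nhds.self_of_nhds

theorem tendsto_removeNth_nearDiagonal (i : Fin (p + 1)) (U : Opens X) :
    Filter.Tendsto (fun w : (Fin (p + 1) → X) × X => (i.removeNth w.1, w.2))
      (nearDiagonal (p + 1) U) (nearDiagonal p U) := by
  have hcont : Continuous fun w : (Fin (p + 1) → X) × X => (i.removeNth w.1, w.2) := by
    unfold Fin.removeNth
    fun_prop
  refine hcont.tendsto_nhdsSet ?_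
  rintro _ ⟨z, hz, rfl⟩
  exact ⟨z, hz, rfl⟩

theorem tendsto_comp_nearDiagonal {f : X → Y} (hf : Continuous f) {U : Opens X} {V : Opens Y}
    (h : Set.MapsTo f U V) :
    Filter.Tendsto (fun w : (Fin p → X) × X => (f ∘ w.1, f w.2))
      (nearDiagonal p U) (nearDiagonal p V) := by
  have hcont : Continuous fun w : (Fin p → X) × X => (f ∘ w.1, f w.2) := by
    unfold Function.comp
    fun_prop
  refine hcont.tendsto_nhdsSet ?_
  rintro _ ⟨z, hz, rfl⟩
  exact ⟨f z, h hz, rfl⟩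

end NearDiagonal

section Coboundary

variable {X A : Type*} (R : Type*) [CommRing R] [AddCommGroup A] [Module R A] {p : ℕ}

/-- The Alexander–Spanier coboundary of a function of `p` points. -/
def coboundary : ((Fin p → X) → A) →ₗ[R] ((Fin (p + 1) → X) → A) where
  toFun f x := ∑ i : Fin (p + 1), (-1 : R) ^ (i : ℕ) • f (i.removeNth x)
  map_add' f g := by
    funext x
    simp only [Pi.add_apply, smul_add, Finset.sum_add_distrib]
  map_smul' r f := by
    funext x
    simp only [Pi.smul_apply, RingHom.id_apply, Finset.smul_sum]
    exact Finset.sum_congr rfl fun i _ => smul_comm _ _ _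

theorem coboundary_apply (f : (Fin p → X) → A) (x : Fin (p + 1) → X) :
    coboundary R f x = ∑ i : Fin (p + 1), (-1 : R) ^ (i : ℕ) • f (i.removeNth x) := rfl

theorem coboundary_zero_apply (f : (Fin 0 → X) → A) (x : Fin 1 → X) :
    coboundary R f x = f Fin.elim0 := by
  rw [coboundary_apply, Fin.sum_univ_one, Fin.val_zero, pow_zero, one_smul]
  exact congrArg f (Subsingleton.elim _ _)

theorem coboundary_cons (f : (Fin (p + 1) → X) → A) (a : X) (x : Fin (p + 1) → X) :
    coboundary R f (Fin.cons a x) =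
      f x - coboundary R (fun y : Fin p → X => f (Fin.cons a y)) x := by
  rw [coboundary_apply, coboundary_apply, Fin.sum_univ_succ, Fin.val_zero, pow_zero, one_smul,
    sub_eq_add_neg, ← Finset.sum_neg_distrib]
  congr 1
  refine Finset.sum_congr rfl fun i _ => ?_
  rw [Fin.val_succ, pow_succ, mul_neg_one, neg_smul]
  congr 3
  funext j
  refine Fin.cases ?_ (fun j => ?_) j <;> simp [Fin.removeNth]

theorem coboundary_coboundary (f : (Fin p → X) → A) : coboundary R (coboundary R f) = 0 := by
  induction p with
  | zero =>
    funext x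
    rw [coboundary_apply, Fin.sum_univ_two]
    simp [coboundary_zero_apply]
  | succ p ih =>
    funext x
    rw [← Fin.cons_self_tail x, coboundary_cons]
    have h : (fun y : Fin (p + 1) → X => coboundary R f (Fin.cons (x 0) y)) =
        f - coboundary R (fun y : Fin p → X => f (Fin.cons (x 0) y)) :=
      funext fun y => coboundary_cons R f (x 0) y
    rw [h, map_sub, ih, sub_zero, sub_self]
    rfl

end Coboundary

/-! ### Cochains with values in forms -/

section Cochain

variable {X : Type*} [TopologicalSpace X] {p q : ℕ}

/-- The functions of `p` points that vanish near the diagonal of `U`. -/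
def locallyZeroFunctions (U : Opens X) : Submodule ℝ ((Fin p → X) → ℝ) where
  carrier := {f | ∀ᶠ w in nearDiagonal p U, f w.1 = 0}
  zero_mem' := Set.mem_ofPred.2 (.of_forall fun _ => rfl)
  add_mem' hf hg := by
    rw [Set.mem_ofPred_eq] at *
    filter_upwards [hf, hg] with w hfw hgw
    rw [Pi.add_apply, hfw, hgw, add_zero]
  smul_mem' r f hf := by
    rw [Set.mem_ofPred_eq] at *
    filter_upwards [hf] with w hfw
    rw [Pi.smul_apply, hfw, smul_zero]

theorem mem_locallyZeroFunctions {U : Opens X} {f : (Fin p → X) → ℝ} :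
    f ∈ locallyZeroFunctions U ↔ ∀ᶠ w in nearDiagonal p U, f w.1 = 0 := Iff.rfl

theorem locallyZeroFunctions_antitone :
    Antitone (locallyZeroFunctions : Opens X → Submodule ℝ ((Fin p → X) → ℝ)) :=
  fun _ _ h _ hf => nearDiagonal_mono h hf

variable {E : Type*} [NormedAddCommGroup E] [NormedSpace ℝ E]
  {M : Type*} [TopologicalSpace M] [ChartedSpace E M]

variable (E M) in
/-- The functions of `p` points with values in the `q`-forms. -/
abbrev Cochain (p q : ℕ) : Type _ := (Fin p → M) → RawForm E M q

/-- The cochains that vanish near the diagonal of `U`. -/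
def locallyZeroCochains (U : Opens M) : Submodule ℝ (Cochain E M p q) where
  carrier := {α | ∀ᶠ w in nearDiagonal p U, α w.1 w.2 = 0}
  zero_mem' := Set.mem_ofPred.2 (.of_forall fun _ => rfl)
  add_mem' hα hβ := by
    rw [Set.mem_ofPred_eq] at *
    filter_upwards [hα, hβ] with w hαw hβw
    rw [Pi.add_apply, add_apply, hαw, hβw, add_zero]
  smul_mem' r α hα := by
    rw [Set.mem_ofPred_eq] at *
    filter_upwards [hα] with w hαw
    rw [Pi.smul_apply, smul_apply, hαw, smul_zero]

theorem mem_locallyZeroCochains {U : Opens M} {α : Cochain E M p q} :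
    α ∈ locallyZeroCochains U ↔ ∀ᶠ w in nearDiagonal p U, α w.1 w.2 = 0 := Iff.rfl

theorem smodEq_locallyZeroCochains {U : Opens M} {α β : Cochain E M p q} :
    α ≡ β [SMOD locallyZeroCochains U] ↔ ∀ᶠ w in nearDiagonal p U, α w.1 w.2 = β w.1 w.2 := by
  rw [SModEq.sub_mem, mem_locallyZeroCochains]
  exact Filter.eventually_congr (.of_forall fun w => sub_eq_zero (a := α w.1 w.2))

theorem locallyZeroCochains_antitone :
    Antitone (locallyZeroCochains : Opens M → Submodule ℝ (Cochain E M p q)) :=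
  fun _ _ h _ hα => nearDiagonal_mono h hα

theorem coboundary_cochain_apply (α : Cochain E M p q) (x : Fin (p + 1) → M) (y : M) :
    coboundary ℝ α x y = ∑ i : Fin (p + 1), (-1 : ℝ) ^ (i : ℕ) • α (i.removeNth x) y :=
  Finset.sum_apply y Finset.univ fun i : Fin (p + 1) => (-1 : ℝ) ^ (i : ℕ) • α (i.removeNth x)

theorem coboundary_congr {U : Opens M} {α β : Cochain E M p q}
    (h : α ≡ β [SMOD locallyZeroCochains U]) :
    coboundary ℝ α ≡ coboundary ℝ β [SMOD locallyZeroCochains U] := by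
  rw [smodEq_locallyZeroCochains] at h ⊢
  filter_upwards [Filter.eventually_all.2 fun i =>
    (tendsto_removeNth_nearDiagonal i U).eventually h] with w hw
  rw [coboundary_cochain_apply, coboundary_cochain_apply]
  exact Finset.sum_congr rfl fun i _ => by rw [hw i]

/-- The cochains whose values are smooth forms near the diagonal of `U`. Nothing is required of
the dependence on the points. -/
def smoothCochains (U : Opens M) : Submodule ℝ (Cochain E M p q) where
  carrier := {α | ∀ᶠ w in nearDiagonal p U, IsSmoothAt (α w.1) w.2}
  zero_mem' := Set.mem_ofPred.2 (.of_forall fun _ => isSmoothAt_zero _)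
  add_mem' hα hβ := by
    rw [Set.mem_ofPred_eq] at *
    filter_upwards [hα, hβ] with w hαw hβw using hαw.add hβw
  smul_mem' r α hα := by
    rw [Set.mem_ofPred_eq] at *
    filter_upwards [hα] with w hαw using hαw.smul r

theorem mem_smoothCochains {U : Opens M} {α : Cochain E M p q} :
    α ∈ smoothCochains U ↔ ∀ᶠ w in nearDiagonal p U, IsSmoothAt (α w.1) w.2 := Iff.rfl

theorem smoothCochains_antitone :
    Antitone (smoothCochains : Opens M → Submodule ℝ (Cochain E M p q)) :=
  fun _ _ h _ hα => nearDiagonal_mono h hα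

theorem mem_smoothCochains_of_smodEq {U : Opens M} {α β : Cochain E M p q}
    (hα : α ∈ smoothCochains U) (h : β ≡ α [SMOD locallyZeroCochains U]) :
    β ∈ smoothCochains U := by
  filter_upwards [hα, eventually_eventually_nearDiagonal (smodEq_locallyZeroCochains.1 h)]
    with w hw hβ using hw.congr hβ

theorem coboundary_mem_smoothCochains {U : Opens M} {α : Cochain E M p q}
    (hα : α ∈ smoothCochains U) : coboundary ℝ α ∈ smoothCochains U := by
  filter_upwards [Filter.eventually_all.2 fun i =>
    (tendsto_removeNth_nearDiagonal i U).eventually hα] with w hw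
  exact .sum fun i _ => (hw i).smul _

/-- The exterior derivative of the values of a cochain. -/
def dCochain (α : Cochain E M p q) : Cochain E M p (q + 1) := fun x => d (α x)

theorem dCochain_congr {U : Opens M} {α β : Cochain E M p q}
    (h : α ≡ β [SMOD locallyZeroCochains U]) :
    dCochain α ≡ dCochain β [SMOD locallyZeroCochains U] := by
  rw [smodEq_locallyZeroCochains] at h ⊢
  filter_upwards [eventually_eventually_nearDiagonal h] with w hw using d_eq_of_eventuallyEq hw

theorem dCochain_zero : dCochain (0 : Cochain E M p q) = 0 := funext fun _ => d_zero

theorem dCochain_smul (r : ℝ) (α : Cochain E M p q) : dCochain (r • α) = r • dCochain α :=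
  funext fun _ => d_smul _ _

theorem dCochain_add {U : Opens M} {α β : Cochain E M p q} (hα : α ∈ smoothCochains U)
    (hβ : β ∈ smoothCochains U) :
    dCochain (α + β) ≡ dCochain α + dCochain β [SMOD locallyZeroCochains U] := by
  rw [smodEq_locallyZeroCochains]
  filter_upwards [hα, hβ] with w hwα hwβ using hwα.d_add hwβ

theorem dCochain_sub {U : Opens M} {α β : Cochain E M p q} (hα : α ∈ smoothCochains U)
    (hβ : β ∈ smoothCochains U) :
    dCochain (α - β) ≡ dCochain α - dCochain β [SMOD locallyZeroCochains U] := by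
  rw [sub_eq_add_neg, sub_eq_add_neg, ← neg_one_smul ℝ β, ← neg_one_smul ℝ (dCochain β),
    ← dCochain_smul]
  exact dCochain_add hα (Submodule.smul_mem _ _ hβ)

theorem dCochain_coboundary {U : Opens M} {α : Cochain E M p q} (hα : α ∈ smoothCochains U) :
    dCochain (coboundary ℝ α) ≡ coboundary ℝ (dCochain α) [SMOD locallyZeroCochains U] := by
  rw [smodEq_locallyZeroCochains]
  filter_upwards [Filter.eventually_all.2 fun i =>
    (tendsto_removeNth_nearDiagonal i U).eventually hα] with w hw
  rw [coboundary_cochain_apply, dCochain, coboundary_apply,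
    IsSmoothAt.d_sum fun i _ => (hw i).smul _]
  exact Finset.sum_congr rfl fun i _ => by rw [d_smul]; rfl

/-- The functions of `p` points as cochains of constant `0`-forms. -/
def constCochain : ((Fin p → M) → ℝ) →ₗ[ℝ] Cochain E M p 0 where
  toFun c x := constForm (c x)
  map_add' _ _ := rfl
  map_smul' _ _ := rfl

theorem constCochain_mem_smoothCochains (U : Opens M) (c : (Fin p → M) → ℝ) :
    (constCochain c : Cochain E M p 0) ∈ smoothCochains U :=
  mem_smoothCochains.2 (.of_forall fun _ => isSmoothAt_constForm _ _)

theorem dCochain_constCochain (c : (Fin p → M) → ℝ) :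
    dCochain (constCochain c : Cochain E M p 0) = 0 :=
  funext fun _ => d_constForm _

theorem coboundary_constCochain (c : (Fin p → M) → ℝ) :
    coboundary ℝ (constCochain c : Cochain E M p 0) = constCochain (coboundary ℝ c) := by
  funext x y
  rw [coboundary_cochain_apply]
  refine ContinuousAlternatingMap.ext fun v => ?_
  rw [ContinuousAlternatingMap.sum_apply]
  rfl

theorem constCochain_mem_locallyZeroCochains {U : Opens M} {c : (Fin p → M) → ℝ} :
    (constCochain c : Cochain E M p 0) ∈ locallyZeroCochains U ↔ c ∈ locallyZeroFunctions U := by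
  rw [mem_locallyZeroCochains, mem_locallyZeroFunctions]
  refine Filter.eventually_congr (.of_forall fun w => ?_)
  exact constForm_apply_eq_zero_iff

section IsManifold

variable [IsManifold 𝓘(ℝ, E) ∞ M]

theorem dCochain_mem_smoothCochains {U : Opens M} {α : Cochain E M p q}
    (hα : α ∈ smoothCochains U) : dCochain α ∈ smoothCochains U :=
  (mem_smoothCochains.1 hα).mono fun _ h => h.d

theorem dCochain_dCochain {U : Opens M} {α : Cochain E M p q} (hα : α ∈ smoothCochains U) :
    dCochain (dCochain α) ≡ 0 [SMOD locallyZeroCochains U] :=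
  smodEq_locallyZeroCochains.2 ((mem_smoothCochains.1 hα).mono fun _ h => h.d_d)

end IsManifold

end Cochain

/-! ### Exactness of the rows and columns of the double complex -/

theorem finsum_smul_eq_sum {ι R A : Type*} [Semiring R] [AddCommMonoid A] [Module R A] {c : ι → R}
    {S : Finset ι} (hS : ∀ a ∉ S, c a = 0) (m : ι → A) :
    ∑ᶠ a, c a • m a = ∑ a ∈ S, c a • m a :=
  finsum_eq_sum_of_support_subset _ fun a ha => by
    by_contra haS
    exact ha (show c a • m a = 0 by rw [hS a haS, zero_smul])

section Exactness

variable {E : Type*} [NormedAddCommGroup E] [NormedSpace ℝ E]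
  {M : Type*} [TopologicalSpace M] [ChartedSpace E M] {p q : ℕ} {U : Opens M}

/-- The contracting homotopy of the rows of the double complex defined by a partition of unity
`ρ` indexed by the points of `U`. -/
def partitionCone (ρ : U → M → ℝ) (α : Cochain E M (p + 1) q) : Cochain E M p q :=
  fun x y => ∑ᶠ a : U, ρ a y • α (Fin.cons (a : M) x) y

section PartitionCone

variable {ρ : U → M → ℝ} {S : Finset U} {α : Cochain E M (p + 1) q} {y : M}

theorem partitionCone_apply (hS : ∀ a ∉ S, ρ a y = 0) (x : Fin p → M) :
    partitionCone ρ α x y = ∑ a ∈ S, ρ a y • α (Fin.cons (a : M) x) y :=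
  finsum_smul_eq_sum hS _

theorem coboundary_partitionCone_apply (hS : ∀ a ∉ S, ρ a y = 0) (hρ : ∑ a ∈ S, ρ a y = 1)
    {x : Fin (p + 1) → M} (hα : ∀ a ∈ S, coboundary ℝ α (Fin.cons (a : M) x) y = 0) :
    coboundary ℝ (partitionCone ρ α) x y = α x y := by
  have hcons : ∀ a ∈ S, coboundary ℝ (fun x : Fin p → M => α (Fin.cons (a : M) x)) x y = α x y :=
    fun a ha => by
      have h := hα a ha
      rw [coboundary_cons] at h
      exact (sub_eq_zero.1 h).symm
  calc coboundary ℝ (partitionCone ρ α) x y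
      = ∑ i : Fin (p + 1), (-1 : ℝ) ^ (i : ℕ) •
          ∑ a ∈ S, ρ a y • α (Fin.cons (a : M) (i.removeNth x)) y := by
        simp only [coboundary_cochain_apply, partitionCone_apply hS]
    _ = ∑ a ∈ S, ρ a y • coboundary ℝ (fun x : Fin p → M => α (Fin.cons (a : M) x)) x y := by
        simp only [coboundary_cochain_apply, Finset.smul_sum]
        rw [Finset.sum_comm]
        exact Finset.sum_congr rfl fun a _ => Finset.sum_congr rfl fun i _ => smul_comm _ _ _
    _ = α x y := by
        rw [Finset.sum_congr rfl fun a ha => congrArg _ (hcons a ha), ← Finset.sum_smul, hρ,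
          one_smul]

theorem isSmoothAt_partitionCone [IsManifold 𝓘(ℝ, E) ∞ M]
    (hρ : ∀ a, ∀ᶠ z in 𝓝 y, ContMDiffAt 𝓘(ℝ, E) 𝓘(ℝ, ℝ) ∞ (ρ a) z)
    (hS : ∀ᶠ z in 𝓝 y, ∀ a ∉ S, ρ a z = 0) {x : Fin p → M}
    (hα : ∀ a ∈ S, IsSmoothAt (α (Fin.cons (a : M) x)) y) :
    IsSmoothAt (partitionCone ρ α x) y := by
  have hsum : IsSmoothAt (∑ a ∈ S, fsmul (ρ a) (α (Fin.cons (a : M) x))) y :=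
    .sum fun a ha => (hα a ha).fsmul (hρ a)
  refine hsum.congr (hS.mono fun z hz => ?_)
  rw [partitionCone_apply hz]
  exact (Finset.sum_apply z S fun a => fsmul (ρ a) (α (Fin.cons (a : M) x))).symm

end PartitionCone

variable [IsManifold 𝓘(ℝ, E) ∞ M]

theorem smodEq_constCochain_of_dCochain_smodEq_zero {α : Cochain E M (p + 1) 0}
    (hα : α ∈ smoothCochains U) (hd : dCochain α ≡ 0 [SMOD locallyZeroCochains U]) :
    α ≡ constCochain (fun x => toFun (α x) (x 0)) [SMOD locallyZeroCochains U] := by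
  rw [smodEq_locallyZeroCochains] at hd ⊢
  refine eventually_nearDiagonal_iff.2 fun z hz => ?_
  obtain ⟨V, hV, hαV⟩ := eventually_nearDiagonal_iff.1 ((mem_smoothCochains.1 hα).and hd) z hz
  obtain ⟨W, hWV, hW, hzW, hacyclic⟩ := exists_isAcyclic (E := E) hV
  refine ⟨W, hW.mem_nhds hzW, fun x hx y hy => ?_⟩
  have hxV := hαV x fun i => hWV (hx i)
  have heq : toFun (α x) y = toFun (α x) (x 0) := hacyclic.toFun_eq
    (θ := α x) (isSmoothOn_of_forall_isSmoothAt fun y hy => (hxV y (hWV hy)).1)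
    (fun y hy => (hxV y (hWV hy)).2) y hy (x 0) (hx 0)
  exact (constForm_toFun (α x) y).symm.trans (by rw [heq]; rfl)

variable [FiniteDimensional ℝ E] [T2Space M] [SecondCountableTopology M]

variable (E) in
theorem exists_smooth_partition_nearDiagonal {V : U → Set M} (hV : ∀ a : U, V a ∈ 𝓝 (a : M)) :
    ∃ ρ : U → M → ℝ, (∀ a, ∀ x ∈ U, ContMDiffAt 𝓘(ℝ, E) 𝓘(ℝ, ℝ) ∞ (ρ a) x) ∧
      ∀ p, ∀ᶠ w in nearDiagonal p U, ∃ S : Finset U,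
        (∀ a ∈ S, (∀ i, w.1 i ∈ V a) ∧ V a ∈ 𝓝 w.2) ∧
        (∀ i, (∀ a ∉ S, ρ a (w.1 i) = 0) ∧ ∑ a ∈ S, ρ a (w.1 i) = 1) ∧
        ∀ᶠ y in 𝓝 w.2, (∀ a ∉ S, ρ a y = 0) ∧ ∑ a ∈ S, ρ a y = 1 := by
  obtain ⟨ρ, hρ, hsum⟩ := exists_smooth_partition (E := E) U hV
  refine ⟨ρ, hρ, fun p => eventually_nearDiagonal_iff.2 fun z hz => ?_⟩
  obtain ⟨S, hSV, hS⟩ := hsum z hz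
  have hVz : ∀ᶠ y in 𝓝 z, ∀ a ∈ S, V a ∈ 𝓝 y :=
    (Filter.eventually_all_finset S).2 fun a ha => eventually_mem_nhds_iff.2 (hSV a ha)
  refine ⟨_, hVz.and hS.eventually_nhds, fun x hx y hy => ⟨S, fun a ha => ⟨fun i => ?_, ?_⟩,
    fun i => (hx i).2.self_of_nhds, hy.2⟩⟩
  · exact mem_of_mem_nhds ((hx i).1 a ha)
  · exact hy.1 a ha

theorem exists_coboundary_smodEq {α : Cochain E M (p + 1) q} (hα : α ∈ smoothCochains U)
    (hδ : coboundary ℝ α ≡ 0 [SMOD locallyZeroCochains U]) :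
    ∃ β : Cochain E M p q, β ∈ smoothCochains U ∧
      coboundary ℝ β ≡ α [SMOD locallyZeroCochains U] := by
  choose V hV hαV using fun a : U => eventually_nearDiagonal_iff.1 (mem_smoothCochains.1 hα) a a.2
  choose V' hV' hδV using fun a : U =>
    eventually_nearDiagonal_iff.1 (smodEq_locallyZeroCochains.1 hδ) a a.2
  obtain ⟨ρ, hρ, hsum⟩ :=
    exists_smooth_partition_nearDiagonal E fun a => Filter.inter_mem (hV a) (hV' a)
  have hcons : ∀ {p : ℕ} {x : Fin p → M} {a : U}, (∀ i, x i ∈ V a ∩ V' a) →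
      ∀ i : Fin (p + 1), (Fin.cons (a : M) x : Fin (p + 1) → M) i ∈ V a ∩ V' a :=
    fun {_ _} a hx => Fin.cases ⟨mem_of_mem_nhds (hV a), mem_of_mem_nhds (hV' a)⟩ hx
  refine ⟨partitionCone ρ α, ?_, smodEq_locallyZeroCochains.2 ?_⟩
  · have hUp : ∀ᶠ w in nearDiagonal p U, w.2 ∈ U :=
      eventually_nearDiagonal_iff.2 fun z hz => ⟨U, U.isOpen.mem_nhds hz, fun _ _ _ hy => hy⟩
    refine mem_smoothCochains.2 ?_
    filter_upwards [hUp, hsum p] with w hwU ⟨S, hSV, _, hS⟩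
    refine isSmoothAt_partitionCone
      (fun a => (U.isOpen.eventually_mem hwU).mono fun z hz => hρ a z hz)
      (hS.mono fun z hz => hz.1) fun a ha => ?_
    exact hαV a _ (fun i => (hcons (hSV a ha).1 i).1) _ (mem_of_mem_nhds (hSV a ha).2).1
  · filter_upwards [hsum (p + 1)] with w ⟨S, hSV, _, hS⟩
    refine coboundary_partitionCone_apply hS.self_of_nhds.1 hS.self_of_nhds.2 fun a ha => ?_
    exact hδV a _ (fun i => (hcons (hSV a ha).1 i).2) _ (mem_of_mem_nhds (hSV a ha).2).2

theorem exists_dCochain_smodEq {α : Cochain E M (p + 1) (q + 1)} (hα : α ∈ smoothCochains U)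
    (hd : dCochain α ≡ 0 [SMOD locallyZeroCochains U]) :
    ∃ β : Cochain E M (p + 1) q, β ∈ smoothCochains U ∧
      dCochain β ≡ α [SMOD locallyZeroCochains U] := by
  have hprim : ∀ a : U, ∃ V ∈ 𝓝 (a : M), IsOpen V ∧ ∀ x : Fin (p + 1) → M, (∀ i, x i ∈ V) →
      ∃ η : RawForm E M q, IsSmoothOn V η ∧ ∀ y ∈ V, d η y = α x y := fun a => by
    obtain ⟨V, hV, hαV⟩ := eventually_nearDiagonal_iff.1
      ((mem_smoothCochains.1 hα).and (smodEq_locallyZeroCochains.1 hd)) a a.2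
    obtain ⟨W, hWV, hW, haW, hacyclic⟩ := exists_isAcyclic (E := E) hV
    exact ⟨W, hW.mem_nhds haW, hW, fun x hx => hacyclic.exists_d_eq
      (isSmoothOn_of_forall_isSmoothAt fun y hy => (hαV x (fun i => hWV (hx i)) y (hWV hy)).1)
      fun y hy => (hαV x (fun i => hWV (hx i)) y (hWV hy)).2⟩
  choose V hVnhds hVo hV using hprim
  choose! η hη hdη using hV
  obtain ⟨ρ, -, hsum⟩ := exists_smooth_partition_nearDiagonal E hVnhds
  let β : Cochain E M (p + 1) q := fun x => ∑ᶠ a, ρ a (x 0) • η a x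
  suffices hβ : ∀ᶠ w in nearDiagonal (p + 1) U,
      IsSmoothAt (β w.1) w.2 ∧ d (β w.1) w.2 = α w.1 w.2 from
    ⟨β, mem_smoothCochains.2 (hβ.mono fun _ h => h.1),
      smodEq_locallyZeroCochains.2 (hβ.mono fun _ h => h.2)⟩
  filter_upwards [hsum (p + 1)] with w ⟨S, hSV, hS, _⟩
  have hβS : β w.1 = ∑ a ∈ S, ρ a (w.1 0) • η a w.1 := finsum_smul_eq_sum (hS 0).1 _
  have hsmooth : ∀ a ∈ S, IsSmoothAt (ρ a (w.1 0) • η a w.1) w.2 := fun a ha =>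
    ((hη a _ (hSV a ha).1).isSmoothAt (hVo a) (mem_of_mem_nhds (hSV a ha).2)).smul _
  refine hβS ▸ ⟨.sum hsmooth, ?_⟩
  calc d (∑ a ∈ S, ρ a (w.1 0) • η a w.1) w.2
      = ∑ a ∈ S, d (ρ a (w.1 0) • η a w.1) w.2 := IsSmoothAt.d_sum hsmooth
    _ = ∑ a ∈ S, ρ a (w.1 0) • α w.1 w.2 := Finset.sum_congr rfl fun a ha => by
        rw [d_smul, smul_apply, hdη a _ (hSV a ha).1 _ (mem_of_mem_nhds (hSV a ha).2)]
    _ = α w.1 w.2 := by rw [← Finset.sum_smul, (hS 0).2, one_smul]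

end Exactness

/-! ### Classes that vanish outside a compact set -/

section Quotient

variable {R V V' : Type*} [Ring R] [AddCommGroup V] [Module R V] [AddCommGroup V'] [Module R V']

theorem nonempty_quotient_equiv_of_relation {A B : Submodule R V} {A' B' : Submodule R V'}
    (G : Submodule R (V × V')) (hl : ∀ a ∈ A, ∃ a' ∈ A', (a, a') ∈ G)
    (hr : ∀ a' ∈ A', ∃ a ∈ A, (a, a') ∈ G)
    (hB : ∀ a ∈ A, ∀ a' ∈ A', (a, a') ∈ G → (a ∈ B ↔ a' ∈ B')) :
    Nonempty ((A ⧸ B.submoduleOf A) ≃ₗ[R] (A' ⧸ B'.submoduleOf A')) := by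
  let H : Submodule R (V × V') := G ⊓ A.prod A'
  let f : H →ₗ[R] A := ((LinearMap.fst R V V').comp H.subtype).codRestrict A fun g => g.2.2.1
  let f' : H →ₗ[R] A' := ((LinearMap.snd R V V').comp H.subtype).codRestrict A' fun g => g.2.2.2
  let π := (B.submoduleOf A).mkQ.comp f
  let π' := (B'.submoduleOf A').mkQ.comp f'
  have hπ : Function.Surjective π := (Submodule.mkQ_surjective _).comp fun a => by
    obtain ⟨a', ha', h⟩ := hl a a.2
    exact ⟨⟨(a, a'), h, a.2, ha'⟩, rfl⟩
  have hπ' : Function.Surjective π' := (Submodule.mkQ_surjective _).comp fun a' => by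
    obtain ⟨a, ha, h⟩ := hr a' a'.2
    exact ⟨⟨(a, a'), h, ha, a'.2⟩, rfl⟩
  have hker : LinearMap.ker π = LinearMap.ker π' := by
    ext g
    simp only [π, π', LinearMap.mem_ker, LinearMap.comp_apply, Submodule.mkQ_apply,
      Submodule.Quotient.mk_eq_zero]
    exact hB _ g.2.2.1 _ g.2.2.2 g.2.1
  exact ⟨(π.quotKerEquivOfSurjective hπ).symm ≪≫ₗ Submodule.quotEquivOfEq _ _ hker ≪≫ₗ
    π'.quotKerEquivOfSurjective hπ'⟩

theorem mem_map_sup_iff_exists_smodEq {B : Submodule R V} {N : Submodule R V'} {f : V →ₗ[R] V'}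
    {x : V'} : x ∈ B.map f ⊔ N ↔ ∃ b ∈ B, f b ≡ x [SMOD N] := by
  simp only [Submodule.mem_sup, Submodule.mem_map, exists_exists_and_eq_and]
  refine exists_congr fun b => and_congr_right fun _ => ?_
  rw [SModEq.comm, SModEq.sub_mem]
  exact ⟨fun ⟨z, hz, h⟩ => by rwa [← h, add_sub_cancel_left],
    fun h => ⟨x - f b, h, add_sub_cancel _ _⟩⟩

end Quotient

section AtInfinity

variable {X Y : Type*} [TopologicalSpace X] [T2Space X] [TopologicalSpace Y] [T2Space Y]
  {R V V' : Type*} [Ring R] [AddCommGroup V] [Module R V] [AddCommGroup V'] [Module R V']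

/-- The elements that belong to `B U` for the complement `U` of some compact set. The family `B`
is meant to be antitone; otherwise this is the span of these elements. -/
def atInfinity (B : Opens X → Submodule R V) : Submodule R V :=
  ⨆ K : Compacts X, B K.toCloseds.compl

theorem mem_atInfinity {B : Opens X → Submodule R V} (hB : Antitone B) {v : V} :
    v ∈ atInfinity B ↔ ∃ K : Compacts X, v ∈ B K.toCloseds.compl :=
  have hmono : Monotone fun K : Compacts X => B K.toCloseds.compl := fun K L h =>
    hB (Set.compl_subset_compl.2 h : (L : Set X)ᶜ ⊆ (K : Set X)ᶜ)
  Submodule.mem_iSup_of_directed _ hmono.directed_le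

/-- The space of the elements of `Z` whose class modulo `B` vanishes outside a compact set,
modulo those whose class vanishes everywhere. -/
abbrev CohomologyAtInfinity (Z : Submodule R V) (B : Opens X → Submodule R V) : Type _ :=
  (Z ⊓ atInfinity B : Submodule R V) ⧸ (B ⊤).submoduleOf (Z ⊓ atInfinity B)

theorem nonempty_cohomologyAtInfinity_equiv_of_homeomorph (h : X ≃ₜ Y) {Z : Submodule R V}
    {B : Opens X → Submodule R V} {Z' : Submodule R V'} {B' : Opens Y → Submodule R V'}
    (hB : Antitone B) (hB' : Antitone B') (G : Submodule R (V × V'))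
    (hl : ∀ z ∈ Z, ∃ z' ∈ Z', (z, z') ∈ G) (hr : ∀ z' ∈ Z', ∃ z ∈ Z, (z, z') ∈ G)
    (hG : ∀ z z', (z, z') ∈ G → ∀ U : Opens X, z ∈ B U ↔ z' ∈ B' (h.opensCongr U)) :
    Nonempty (CohomologyAtInfinity Z B ≃ₗ[R] CohomologyAtInfinity Z' B') := by
  have hcompl (K : Compacts X) : h.opensCongr K.toCloseds.compl =
      (Compacts.equiv h K).toCloseds.compl :=
    Opens.ext (by
      change h.symm ⁻¹' (K : Set X)ᶜ = (h '' K)ᶜ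
      rw [Set.preimage_compl, h.image_eq_preimage_symm])
  have hinf (z : V) (z' : V') (hz : (z, z') ∈ G) : z ∈ atInfinity B ↔ z' ∈ atInfinity B' := by
    rw [mem_atInfinity hB, mem_atInfinity hB']
    refine (Compacts.equiv h).exists_congr fun K => ?_
    rw [hG z z' hz, hcompl]
  refine nonempty_quotient_equiv_of_relation G ?_ ?_ ?_
  · rintro z ⟨hz, hzB⟩
    obtain ⟨z', hz', hzz'⟩ := hl z hz
    exact ⟨z', ⟨hz', (hinf z z' hzz').1 hzB⟩, hzz'⟩
  · rintro z' ⟨hz', hzB⟩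
    obtain ⟨z, hz, hzz'⟩ := hr z' hz'
    exact ⟨z, ⟨hz, (hinf z z' hzz').2 hzB⟩, hzz'⟩
  · intro z _ z' _ hzz'
    rw [hG z z' hzz', map_top]

theorem nonempty_cohomologyAtInfinity_equiv {Z : Submodule R V} {B : Opens X → Submodule R V}
    {Z' : Submodule R V'} {B' : Opens X → Submodule R V'} (hB : Antitone B) (hB' : Antitone B')
    (G : Submodule R (V × V')) (hl : ∀ z ∈ Z, ∃ z' ∈ Z', (z, z') ∈ G)
    (hr : ∀ z' ∈ Z', ∃ z ∈ Z, (z, z') ∈ G)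
    (hG : ∀ z z', (z, z') ∈ G → ∀ U : Opens X, z ∈ B U ↔ z' ∈ B' U) :
    Nonempty (CohomologyAtInfinity Z B ≃ₗ[R] CohomologyAtInfinity Z' B') :=
  nonempty_cohomologyAtInfinity_equiv_of_homeomorph (.refl X) hB hB' G hl hr hG

end AtInfinity

/-! ### Alexander–Spanier cohomology -/

section Pullback

variable {X Y : Type*} {p : ℕ}

/-- The pullback along `f` of the functions of `p` points. -/
def pullback (f : X → Y) : ((Fin p → Y) → ℝ) →ₗ[ℝ] ((Fin p → X) → ℝ) :=
  LinearMap.funLeft ℝ ℝ (f ∘ ·)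

theorem pullback_pullback_symm (h : X ≃ Y) (c : (Fin p → X) → ℝ) :
    pullback h (pullback h.symm c) = c :=
  funext fun x => congrArg c (funext fun i => h.symm_apply_apply (x i))

theorem coboundary_pullback (f : X → Y) (c : (Fin p → Y) → ℝ) :
    coboundary ℝ (pullback f c) = pullback f (coboundary ℝ c) := rfl

end Pullback

section Spanier

variable {X Y : Type*} [TopologicalSpace X] [TopologicalSpace Y] {p : ℕ}

variable (X) in
/-- The Alexander–Spanier cocycles of degree `p`, which are functions of `p + 1` points. Cocycles
that agree near the diagonal are not identified. -/
def spanierCocycles (p : ℕ) : Submodule ℝ ((Fin (p + 1) → X) → ℝ) :=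
  (locallyZeroFunctions ⊤).comap (coboundary ℝ)

/-- The Alexander–Spanier coboundaries of degree `p` on `U`, including the functions that vanish
near the diagonal. In degree `0` the cohomology is not reduced. -/
def spanierCoboundaries (U : Opens X) : (p : ℕ) → Submodule ℝ ((Fin (p + 1) → X) → ℝ)
  | 0 => locallyZeroFunctions U
  | _ + 1 => (⊤ : Submodule ℝ _).map (coboundary ℝ) ⊔ locallyZeroFunctions U

theorem mem_spanierCoboundaries_succ {U : Opens X} {c : (Fin (p + 2) → X) → ℝ} :
    c ∈ spanierCoboundaries U (p + 1) ↔
      ∃ b : (Fin (p + 1) → X) → ℝ, coboundary ℝ b ≡ c [SMOD locallyZeroFunctions U] := by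
  simp only [spanierCoboundaries, mem_map_sup_iff_exists_smodEq, Submodule.mem_top, true_and]

theorem locallyZeroFunctions_le_spanierCoboundaries (U : Opens X) :
    locallyZeroFunctions U ≤ spanierCoboundaries U p := by
  cases p with
  | zero => exact le_rfl
  | succ p => exact le_sup_right

theorem spanierCoboundaries_antitone :
    Antitone fun U : Opens X => spanierCoboundaries U p := fun U V h => by
  cases p with
  | zero => exact locallyZeroFunctions_antitone h
  | succ p => exact sup_le_sup_left (locallyZeroFunctions_antitone h) _

theorem pullback_mem_locallyZeroFunctions {f : X → Y} (hf : Continuous f) {U : Opens X}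
    {V : Opens Y} (h : Set.MapsTo f U V) {c : (Fin p → Y) → ℝ}
    (hc : c ∈ locallyZeroFunctions V) : pullback f c ∈ locallyZeroFunctions U :=
  (tendsto_comp_nearDiagonal hf h).eventually hc

theorem pullback_mem_spanierCocycles {f : X → Y} (hf : Continuous f)
    {c : (Fin (p + 1) → Y) → ℝ} (hc : c ∈ spanierCocycles Y p) :
    pullback f c ∈ spanierCocycles X p := by
  rw [spanierCocycles, Submodule.mem_comap, coboundary_pullback]
  exact pullback_mem_locallyZeroFunctions hf (Set.mapsTo_univ _ _) hc

theorem pullback_mem_spanierCoboundaries {f : X → Y} (hf : Continuous f) {U : Opens X}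
    {V : Opens Y} (h : Set.MapsTo f U V) {c : (Fin (p + 1) → Y) → ℝ}
    (hc : c ∈ spanierCoboundaries V p) : pullback f c ∈ spanierCoboundaries U p := by
  cases p with
  | zero => exact pullback_mem_locallyZeroFunctions hf h hc
  | succ p =>
    obtain ⟨b, hb⟩ := mem_spanierCoboundaries_succ.1 hc
    refine mem_spanierCoboundaries_succ.2 ⟨pullback f b, ?_⟩
    rw [coboundary_pullback, SModEq.sub_mem, ← map_sub]
    exact pullback_mem_locallyZeroFunctions hf h (SModEq.sub_mem.1 hb)

theorem pullback_symm_mem_spanierCoboundaries_iff (h : X ≃ₜ Y) {U : Opens X}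
    {c : (Fin (p + 1) → X) → ℝ} :
    pullback h.symm c ∈ spanierCoboundaries (h.opensCongr U) p ↔ c ∈ spanierCoboundaries U p := by
  refine ⟨fun hc => ?_,
    pullback_mem_spanierCoboundaries h.symm.continuous (Set.mapsTo_preimage h.symm U)⟩
  rw [← pullback_pullback_symm h.toEquiv c]
  exact pullback_mem_spanierCoboundaries h.continuous
    (fun x hx => show h.symm (h x) ∈ U by rwa [h.symm_apply_apply]) hc

variable [T2Space X] [T2Space Y]

variable (X) in
/-- The Alexander–Spanier classes of degree `p` that vanish outside a compact set. -/
abbrev SpanierCohomologyAtInfinity (p : ℕ) : Type _ :=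
  CohomologyAtInfinity (spanierCocycles X p) fun U => spanierCoboundaries U p

theorem nonempty_spanierCohomologyAtInfinity_equiv_of_homeomorph (h : X ≃ₜ Y) (p : ℕ) :
    Nonempty (SpanierCohomologyAtInfinity X p ≃ₗ[ℝ] SpanierCohomologyAtInfinity Y p) := by
  refine nonempty_cohomologyAtInfinity_equiv_of_homeomorph h spanierCoboundaries_antitone
    spanierCoboundaries_antitone (pullback h.symm).graph ?_ ?_ ?_
  · exact fun c hc => ⟨pullback h.symm c, pullback_mem_spanierCocycles h.symm.continuous hc, rfl⟩
  · exact fun c hc => ⟨pullback h c, pullback_mem_spanierCocycles h.continuous hc,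
      (pullback_pullback_symm h.symm.toEquiv c).symm⟩
  · intro c c' hc U
    obtain rfl : c' = pullback h.symm c := hc
    exact (pullback_symm_mem_spanierCoboundaries_iff h).symm

end Spanier

/-! ### The zigzag from de Rham to Alexander–Spanier cohomology -/

section Zigzag

variable {E : Type*} [NormedAddCommGroup E] [NormedSpace ℝ E]
  {M : Type*} [TopologicalSpace M] [ChartedSpace E M] {p q : ℕ} {U : Opens M}

/-- The cochains on `U` with smooth closed values, up to cochains that vanish near the diagonal. -/
def closedCochains (U : Opens M) : Submodule ℝ (Cochain E M p q) where
  carrier := {α | α ∈ smoothCochains U ∧ dCochain α ≡ 0 [SMOD locallyZeroCochains U]}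
  zero_mem' := ⟨zero_mem _, by rw [dCochain_zero]⟩
  add_mem' := fun ⟨hα, hdα⟩ ⟨hβ, hdβ⟩ => ⟨add_mem hα hβ,
    (dCochain_add hα hβ).trans (by simpa only [add_zero] using hdα.add hdβ)⟩
  smul_mem' r α := fun ⟨hα, hdα⟩ => ⟨Submodule.smul_mem _ r hα, by
    simpa only [dCochain_smul, smul_zero] using hdα.smul r⟩

theorem mem_closedCochains {α : Cochain E M p q} :
    α ∈ closedCochains U ↔
      α ∈ smoothCochains U ∧ dCochain α ≡ 0 [SMOD locallyZeroCochains U] := Iff.rfl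

theorem mem_closedCochains_of_smodEq {α β : Cochain E M p q} (hα : α ∈ closedCochains U)
    (h : β ≡ α [SMOD locallyZeroCochains U]) : β ∈ closedCochains U :=
  ⟨mem_smoothCochains_of_smodEq hα.1 h, (dCochain_congr h).trans hα.2⟩

variable (E M) in
/-- The cochains on `M` that are cocycles for both differentials of the double complex. -/
def doubleCocycles (p q : ℕ) : Submodule ℝ (Cochain E M p q) :=
  closedCochains ⊤ ⊓ (locallyZeroCochains ⊤).comap (coboundary ℝ)

theorem mem_doubleCocycles {α : Cochain E M p q} :
    α ∈ doubleCocycles E M p q ↔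
      α ∈ closedCochains ⊤ ∧ coboundary ℝ α ≡ 0 [SMOD locallyZeroCochains ⊤] := by
  rw [SModEq.zero]
  rfl

/-- The double cocycles on `U` that represent zero: in positive form degree, the images of
`d ∘ δ`; in form degree zero, the Alexander–Spanier coboundaries. -/
def nullCochains (U : Opens M) (p : ℕ) : (q : ℕ) → Submodule ℝ (Cochain E M (p + 1) q)
  | 0 => (spanierCoboundaries U p).map constCochain ⊔ locallyZeroCochains U
  | q + 1 =>
    { carrier := {α | ∃ β : Cochain E M p q, β ∈ smoothCochains U ∧
        dCochain (coboundary ℝ β) ≡ α [SMOD locallyZeroCochains U]}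
      zero_mem' := ⟨0, zero_mem _, by rw [map_zero, dCochain_zero]⟩
      add_mem' := fun ⟨β, hβ, h⟩ ⟨γ, hγ, h'⟩ => ⟨β + γ, add_mem hβ hγ, by
        rw [map_add]
        exact (dCochain_add (coboundary_mem_smoothCochains hβ)
          (coboundary_mem_smoothCochains hγ)).trans (h.add h')⟩
      smul_mem' := fun r _ ⟨β, hβ, h⟩ => ⟨r • β, Submodule.smul_mem _ r hβ, by
        rw [map_smul, dCochain_smul]
        exact h.smul r⟩ }

theorem mem_nullCochains_zero {α : Cochain E M (p + 1) 0} :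
    α ∈ nullCochains U p 0 ↔
      ∃ c ∈ spanierCoboundaries U p, constCochain c ≡ α [SMOD locallyZeroCochains U] :=
  mem_map_sup_iff_exists_smodEq

theorem mem_nullCochains_succ {α : Cochain E M (p + 1) (q + 1)} :
    α ∈ nullCochains U p (q + 1) ↔ ∃ β : Cochain E M p q, β ∈ smoothCochains U ∧
      dCochain (coboundary ℝ β) ≡ α [SMOD locallyZeroCochains U] := Iff.rfl

theorem nullCochains_antitone :
    Antitone fun U : Opens M => (nullCochains U p q : Submodule ℝ (Cochain E M (p + 1) q)) :=
  fun U V h => by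
    cases q with
    | zero =>
      exact sup_le_sup (Submodule.map_mono (spanierCoboundaries_antitone h))
        (locallyZeroCochains_antitone h)
    | succ q =>
      exact fun α ⟨β, hβ, hα⟩ =>
        ⟨β, smoothCochains_antitone h hβ, hα.mono (locallyZeroCochains_antitone h)⟩

theorem constCochain_smodEq_constCochain {b c : (Fin p → M) → ℝ} :
    (constCochain b : Cochain E M p 0) ≡ constCochain c [SMOD locallyZeroCochains U] ↔
      b ≡ c [SMOD locallyZeroFunctions U] := by
  rw [SModEq.sub_mem, SModEq.sub_mem, ← map_sub, constCochain_mem_locallyZeroCochains]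

theorem mem_nullCochains_zero_iff_of_smodEq {α : Cochain E M (p + 1) 0}
    {c : (Fin (p + 1) → M) → ℝ} (h : α ≡ constCochain c [SMOD locallyZeroCochains U]) :
    α ∈ nullCochains U p 0 ↔ c ∈ spanierCoboundaries U p := by
  rw [mem_nullCochains_zero]
  refine ⟨fun ⟨b, hb, hbα⟩ => ?_, fun hc => ⟨c, hc, h.symm⟩⟩
  have hbc := constCochain_smodEq_constCochain.1 (hbα.trans h)
  have hsub := locallyZeroFunctions_le_spanierCoboundaries U (SModEq.sub_mem.1 hbc.symm)
  rw [← sub_add_cancel c b]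
  exact add_mem hsub hb

theorem constCochain_mem_doubleCocycles_iff {c : (Fin (p + 1) → M) → ℝ} :
    constCochain c ∈ doubleCocycles E M (p + 1) 0 ↔ c ∈ spanierCocycles M p := by
  rw [mem_doubleCocycles, coboundary_constCochain, SModEq.zero,
    constCochain_mem_locallyZeroCochains]
  exact and_iff_right ⟨constCochain_mem_smoothCochains ⊤ c, by rw [dCochain_constCochain]⟩

theorem mem_doubleCocycles_of_smodEq {α β : Cochain E M p q} (hα : α ∈ doubleCocycles E M p q)
    (h : β ≡ α [SMOD locallyZeroCochains ⊤]) : β ∈ doubleCocycles E M p q := by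
  rw [mem_doubleCocycles] at hα ⊢
  exact ⟨mem_closedCochains_of_smodEq hα.1 h, (coboundary_congr h).trans hα.2⟩

/-- The cochain with constant value a given form. -/
def formCochain : RawForm E M q →ₗ[ℝ] Cochain E M p q where
  toFun θ _ := θ
  map_add' _ _ := rfl
  map_smul' _ _ := rfl

theorem exists_formCochain_eq (β : Cochain E M 0 q) : ∃ θ, formCochain θ = β :=
  ⟨β Fin.elim0, funext fun _ => congrArg β (Subsingleton.elim _ _)⟩

theorem coboundary_formCochain (θ : RawForm E M q) :
    coboundary ℝ (formCochain θ : Cochain E M 0 q) = formCochain θ :=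
  funext fun x => coboundary_zero_apply ℝ _ x

theorem dCochain_formCochain (θ : RawForm E M q) :
    dCochain (formCochain θ : Cochain E M p q) = formCochain (d θ) := rfl

theorem formCochain_smodEq_iff {θ η : RawForm E M q} :
    (formCochain θ : Cochain E M p q) ≡ formCochain η [SMOD locallyZeroCochains U] ↔
      ∀ x ∈ U, θ x = η x :=
  smodEq_locallyZeroCochains.trans (eventually_snd_nearDiagonal_iff (P := fun x => θ x = η x))

theorem formCochain_mem_smoothCochains_iff {θ : RawForm E M q} :
    (formCochain θ : Cochain E M p q) ∈ smoothCochains U ↔ IsSmoothOn U θ :=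
  (eventually_snd_nearDiagonal_iff (P := IsSmoothAt θ)).trans
    ⟨isSmoothOn_of_forall_isSmoothAt, fun h _ hx => h.isSmoothAt U.isOpen hx⟩

theorem formCochain_mem_doubleCocycles_iff {θ : RawForm E M q} :
    formCochain θ ∈ doubleCocycles E M 1 q ↔ θ ∈ closedForms E M q := by
  have hδ : coboundary ℝ (formCochain θ : Cochain E M 1 q) = 0 := by
    rw [← coboundary_formCochain, coboundary_coboundary]
  have hd : dCochain (formCochain θ : Cochain E M 1 q) ≡ 0 [SMOD locallyZeroCochains ⊤] ↔
      d θ = 0 := by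
    rw [dCochain_formCochain, ← map_zero formCochain, formCochain_smodEq_iff]
    exact ⟨fun h => funext fun x => h x trivial, fun h x _ => congrFun h x⟩
  rw [mem_doubleCocycles, mem_closedCochains, formCochain_mem_smoothCochains_iff, hd, hδ]
  exact and_iff_left rfl

variable (E q) in
/-- The forms of degree `q` that are exact on `U`. -/
def exactFormsOn (U : Opens M) : Submodule ℝ (RawForm E M q) where
  carrier := {θ | IsExactOn (U : Set M) θ}
  zero_mem' := .zero _
  add_mem' := .add U.isOpen
  smul_mem' c _ := .smul c

theorem mem_exactFormsOn {θ : RawForm E M q} :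
    θ ∈ exactFormsOn E q U ↔ IsExactOn (U : Set M) θ := Iff.rfl

theorem exactFormsOn_antitone : Antitone (exactFormsOn E q : Opens M → _) :=
  fun _ _ h _ hθ => (mem_exactFormsOn.1 hθ).mono h

theorem mem_exactFormsOn_iff_of_smodEq {θ : RawForm E M q} {α : Cochain E M 1 q}
    (h : formCochain θ ≡ α [SMOD locallyZeroCochains U]) :
    θ ∈ exactFormsOn E q U ↔ α ∈ nullCochains U 0 q := by
  cases q with
  | zero =>
    rw [mem_exactFormsOn, mem_nullCochains_zero]
    constructor
    · exact fun hθ => ⟨0, zero_mem _, (formCochain_smodEq_iff (η := 0).2 hθ).symm.trans h⟩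
    · rintro ⟨c, hc, hα⟩
      have hc0 := SModEq.zero.2 ((constCochain_mem_locallyZeroCochains (E := E)).2 hc)
      exact formCochain_smodEq_iff.1 (h.trans (hα.symm.trans hc0))
  | succ q =>
    rw [mem_exactFormsOn, mem_nullCochains_succ]
    constructor
    · rintro ⟨ν, hν, hdν⟩
      refine ⟨formCochain ν, formCochain_mem_smoothCochains_iff.2 hν, ?_⟩
      rw [coboundary_formCochain]
      exact (formCochain_smodEq_iff.2 hdν).trans h
    · rintro ⟨β, hβ, hα⟩
      obtain ⟨ν, rfl⟩ := exists_formCochain_eq β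
      rw [coboundary_formCochain] at hα
      exact ⟨ν, formCochain_mem_smoothCochains_iff.1 hβ,
        formCochain_smodEq_iff.1 (hα.trans h.symm)⟩

theorem closedFormsExactAtInfinity_eq [T2Space M] :
    closedFormsExactAtInfinity E M q = closedForms E M q ⊓ atInfinity (exactFormsOn E q) := by
  ext θ
  rw [Submodule.mem_inf, mem_atInfinity exactFormsOn_antitone]
  exact and_congr_right fun _ => ⟨fun ⟨K, hK, h⟩ => ⟨⟨K, hK⟩, h⟩, fun ⟨K, h⟩ => ⟨K, K.isCompact, h⟩⟩

/-- The pairs `(v, v')` such that `f v` and `v'` agree modulo `N`. -/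
def graphModulo {R V V' : Type*} [Ring R] [AddCommGroup V] [Module R V] [AddCommGroup V']
    [Module R V'] (f : V →ₗ[R] V') (N : Submodule R V') : Submodule R (V × V') where
  carrier := {z | f z.1 ≡ z.2 [SMOD N]}
  zero_mem' := by
    simpa only [Set.mem_ofPred_eq, Prod.fst_zero, Prod.snd_zero, map_zero] using SModEq.rfl
  add_mem' h h' := by
    simpa only [Set.mem_ofPred_eq, Prod.fst_add, Prod.snd_add, map_add] using SModEq.add h h'
  smul_mem' r _ h := by
    simpa only [Set.mem_ofPred_eq, Prod.smul_fst, Prod.smul_snd, map_smul] using SModEq.smul h r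

variable (E M) in
/-- The pairs `(μ, ν)` such that some cochain `β` satisfies `d β = μ` and `δ β = ν`: one step of
the zigzag through the double complex. -/
def zigzag (p q : ℕ) : Submodule ℝ (Cochain E M p (q + 1) × Cochain E M (p + 1) q) where
  carrier := {z | ∃ β : Cochain E M p q, β ∈ smoothCochains ⊤ ∧
    dCochain β ≡ z.1 [SMOD locallyZeroCochains ⊤] ∧
    coboundary ℝ β ≡ z.2 [SMOD locallyZeroCochains ⊤]}
  zero_mem' := ⟨0, zero_mem _, by rw [dCochain_zero]; rfl, by rw [map_zero]; rfl⟩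
  add_mem' := fun ⟨β, hβ, hd, hδ⟩ ⟨γ, hγ, hd', hδ'⟩ =>
    ⟨β + γ, add_mem hβ hγ, (dCochain_add hβ hγ).trans (hd.add hd'), by
      rw [map_add]
      exact hδ.add hδ'⟩
  smul_mem' := fun r _ ⟨β, hβ, hd, hδ⟩ => ⟨r • β, Submodule.smul_mem _ r hβ, by
    rw [dCochain_smul]
    exact hd.smul r, by
    rw [map_smul]
    exact hδ.smul r⟩

section IsManifold

variable [IsManifold 𝓘(ℝ, E) ∞ M] [T2Space M]

variable (E M) in
/-- The classes of a spot of the double complex that vanish outside a compact set. -/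
abbrev DoubleCohomologyAtInfinity (p q : ℕ) : Type _ :=
  CohomologyAtInfinity (doubleCocycles E M (p + 1) q) fun U => nullCochains U p q

variable (E M) in
theorem nonempty_spanierCohomologyAtInfinity_equiv_double (p : ℕ) :
    Nonempty (SpanierCohomologyAtInfinity M p ≃ₗ[ℝ] DoubleCohomologyAtInfinity E M p 0) := by
  refine nonempty_cohomologyAtInfinity_equiv spanierCoboundaries_antitone nullCochains_antitone
    (graphModulo constCochain (locallyZeroCochains ⊤)) ?_ ?_ ?_
  · exact fun c hc => ⟨constCochain c, constCochain_mem_doubleCocycles_iff.2 hc, .rfl⟩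
  · intro α hα
    have hc := smodEq_constCochain_of_dCochain_smodEq_zero hα.1.1 hα.1.2
    exact ⟨_, constCochain_mem_doubleCocycles_iff.1 (mem_doubleCocycles_of_smodEq hα hc.symm),
      hc.symm⟩
  · exact fun c α h U => (mem_nullCochains_zero_iff_of_smodEq
      (h.symm.mono (locallyZeroCochains_antitone le_top))).symm

variable [FiniteDimensional ℝ E] [SecondCountableTopology M]

variable (E M) in
theorem nonempty_cohomologyExactAtInfinity_equiv_double (q : ℕ) :
    Nonempty (CohomologyExactAtInfinity E M q ≃ₗ[ℝ] DoubleCohomologyAtInfinity E M 0 q) := by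
  unfold CohomologyExactAtInfinity
  rw [closedFormsExactAtInfinity_eq]
  refine nonempty_cohomologyAtInfinity_equiv exactFormsOn_antitone nullCochains_antitone
    (graphModulo formCochain (locallyZeroCochains ⊤)) ?_ ?_ ?_
  · exact fun θ hθ => ⟨formCochain θ, formCochain_mem_doubleCocycles_iff.2 hθ, .rfl⟩
  · intro α hα
    obtain ⟨β, -, hβ⟩ := exists_coboundary_smodEq hα.1.1 (mem_doubleCocycles.1 hα).2
    obtain ⟨θ, rfl⟩ := exists_formCochain_eq β
    rw [coboundary_formCochain] at hβ
    exact ⟨θ, formCochain_mem_doubleCocycles_iff.1 (mem_doubleCocycles_of_smodEq hα hβ), hβ⟩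
  · exact fun θ α h U => mem_exactFormsOn_iff_of_smodEq
      (h.mono (locallyZeroCochains_antitone le_top))

theorem mem_nullCochains_iff_exists_closedCochains {ν : Cochain E M (p + 2) q} :
    ν ∈ nullCochains U (p + 1) q ↔ ∃ ζ : Cochain E M (p + 1) q, ζ ∈ closedCochains U ∧
      coboundary ℝ ζ ≡ ν [SMOD locallyZeroCochains U] := by
  cases q with
  | zero =>
    constructor
    · intro hν
      obtain ⟨c, hc, hcν⟩ := mem_nullCochains_zero.1 hν
      obtain ⟨b, hb⟩ := mem_spanierCoboundaries_succ.1 hc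
      refine ⟨constCochain b, ⟨constCochain_mem_smoothCochains U b, ?_⟩, ?_⟩
      · rw [dCochain_constCochain]
      · rw [coboundary_constCochain]
        exact (constCochain_smodEq_constCochain.2 hb).trans hcν
    · rintro ⟨ζ, ⟨hζ, hdζ⟩, hν⟩
      have hconst := coboundary_congr (smodEq_constCochain_of_dCochain_smodEq_zero hζ hdζ)
      rw [coboundary_constCochain] at hconst
      exact mem_nullCochains_zero.2
        ⟨_, mem_spanierCoboundaries_succ.2 ⟨_, .rfl⟩, hconst.symm.trans hν⟩
  | succ q =>
    rw [mem_nullCochains_succ]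
    constructor
    · rintro ⟨β, hβ, hν⟩
      exact ⟨dCochain β, ⟨dCochain_mem_smoothCochains hβ, dCochain_dCochain hβ⟩,
        (dCochain_coboundary hβ).symm.trans hν⟩
    · rintro ⟨ζ, ⟨hζ, hdζ⟩, hν⟩
      obtain ⟨β, hβ, hβζ⟩ := exists_dCochain_smodEq hζ hdζ
      exact ⟨β, hβ, (dCochain_coboundary hβ).trans ((coboundary_congr hβζ).trans hν)⟩

theorem mem_nullCochains_iff_exists_coboundary_eq_zero {μ : Cochain E M (p + 1) (q + 1)} :
    μ ∈ nullCochains U p (q + 1) ↔ ∃ ζ : Cochain E M (p + 1) q, ζ ∈ smoothCochains U ∧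
      coboundary ℝ ζ ≡ 0 [SMOD locallyZeroCochains U] ∧
      dCochain ζ ≡ μ [SMOD locallyZeroCochains U] := by
  rw [mem_nullCochains_succ]
  constructor
  · rintro ⟨β, hβ, hμ⟩
    exact ⟨coboundary ℝ β, coboundary_mem_smoothCochains hβ, by rw [coboundary_coboundary], hμ⟩
  · rintro ⟨ζ, hζ, hδζ, hμ⟩
    obtain ⟨β, hβ, hβζ⟩ := exists_coboundary_smodEq hζ hδζ
    exact ⟨β, hβ, (dCochain_congr hβζ).trans hμ⟩

theorem mem_nullCochains_iff_of_zigzag {μ : Cochain E M (p + 1) (q + 1)}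
    {ν : Cochain E M (p + 2) q} (h : (μ, ν) ∈ zigzag E M (p + 1) q) :
    μ ∈ nullCochains U p (q + 1) ↔ ν ∈ nullCochains U (p + 1) q := by
  obtain ⟨β, hβ, hμ, hν⟩ := h
  have hU := le_top (a := U)
  replace hβ := smoothCochains_antitone hU hβ
  replace hμ := hμ.mono (locallyZeroCochains_antitone hU)
  replace hν := hν.mono (locallyZeroCochains_antitone hU)
  rw [mem_nullCochains_iff_exists_coboundary_eq_zero, mem_nullCochains_iff_exists_closedCochains]
  constructor
  · rintro ⟨ζ, hζ, hδζ, hdζ⟩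
    refine ⟨β - ζ, ⟨sub_mem hβ hζ, (dCochain_sub hβ hζ).trans ?_⟩, ?_⟩
    · simpa only [sub_self] using hμ.sub hdζ
    · simpa only [map_sub, sub_zero] using hν.sub hδζ
  · rintro ⟨ζ, ⟨hζ, hdζ⟩, hδζ⟩
    refine ⟨β - ζ, sub_mem hβ hζ, ?_, (dCochain_sub hβ hζ).trans ?_⟩
    · simpa only [map_sub, sub_self] using hν.sub hδζ
    · simpa only [sub_zero] using hμ.sub hdζ

variable (E M) in
theorem nonempty_doubleCohomologyAtInfinity_equiv (p q : ℕ) :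
    Nonempty (DoubleCohomologyAtInfinity E M p (q + 1) ≃ₗ[ℝ]
      DoubleCohomologyAtInfinity E M (p + 1) q) := by
  refine nonempty_cohomologyAtInfinity_equiv nullCochains_antitone nullCochains_antitone
    (zigzag E M (p + 1) q) ?_ ?_ fun _ _ h _ => mem_nullCochains_iff_of_zigzag h
  · intro μ hμ
    obtain ⟨⟨hs, hd⟩, hδ⟩ := mem_doubleCocycles.1 hμ
    obtain ⟨β, hβ, hdβ⟩ := exists_dCochain_smodEq hs hd
    refine ⟨coboundary ℝ β, mem_doubleCocycles.2 ⟨⟨coboundary_mem_smoothCochains hβ, ?_⟩, ?_⟩,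
      β, hβ, hdβ, .rfl⟩
    · exact (dCochain_coboundary hβ).trans ((coboundary_congr hdβ).trans hδ)
    · rw [coboundary_coboundary]
  · intro ν hν
    obtain ⟨⟨hs, hd⟩, hδ⟩ := mem_doubleCocycles.1 hν
    obtain ⟨β, hβ, hδβ⟩ := exists_coboundary_smodEq hs hδ
    exact ⟨dCochain β, mem_doubleCocycles.2
      ⟨⟨dCochain_mem_smoothCochains hβ, dCochain_dCochain hβ⟩,
        (dCochain_coboundary hβ).symm.trans ((dCochain_congr hδβ).trans hd)⟩, β, hβ, .rfl, hδβ⟩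

variable (E M) in
theorem nonempty_doubleCohomologyAtInfinity_equiv_spanier (p q : ℕ) :
    Nonempty (DoubleCohomologyAtInfinity E M p q ≃ₗ[ℝ] SpanierCohomologyAtInfinity M (p + q)) := by
  induction q generalizing p with
  | zero => exact (nonempty_spanierCohomologyAtInfinity_equiv_double E M p).map .symm
  | succ q ih =>
    obtain ⟨e⟩ := nonempty_doubleCohomologyAtInfinity_equiv E M p q
    obtain ⟨e'⟩ := ih (p + 1)
    rw [show p + (q + 1) = p + 1 + q by omega]
    exact ⟨e ≪≫ₗ e'⟩

variable (E M) in
theorem nonempty_cohomologyExactAtInfinity_equiv_spanier (k : ℕ) :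
    Nonempty (CohomologyExactAtInfinity E M k ≃ₗ[ℝ] SpanierCohomologyAtInfinity M k) := by
  obtain ⟨e⟩ := nonempty_cohomologyExactAtInfinity_equiv_double E M k
  obtain ⟨e'⟩ := nonempty_doubleCohomologyAtInfinity_equiv_spanier E M 0 k
  rw [zero_add] at e'
  exact ⟨e ≪≫ₗ e'⟩

end IsManifold

end Zigzag

end DiffForm

end

theorem mainTheorem7_general
    {E : Type*} [NormedAddCommGroup E] [NormedSpace ℝ E] [FiniteDimensional ℝ E]
    {F : Type*} [NormedAddCommGroup F] [NormedSpace ℝ F] [FiniteDimensional ℝ F]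
    {M : Type*} [TopologicalSpace M] [T2Space M] [SecondCountableTopology M]
    [ChartedSpace E M] [IsManifold 𝓘(ℝ, E) ∞ M]
    {N : Type*} [TopologicalSpace N] [T2Space N] [SecondCountableTopology N]
    [ChartedSpace F N] [IsManifold 𝓘(ℝ, F) ∞ N] (h : M ≃ₜ N) (k : ℕ) :
    Nonempty (DiffForm.CohomologyExactAtInfinity E M k ≃ₗ[ℝ]
      DiffForm.CohomologyExactAtInfinity F N k) := by
  obtain ⟨e⟩ := DiffForm.nonempty_cohomologyExactAtInfinity_equiv_spanier E M k
  obtain ⟨e'⟩ := DiffForm.nonempty_spanierCohomologyAtInfinity_equiv_of_homeomorph h k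
  obtain ⟨e''⟩ := DiffForm.nonempty_cohomologyExactAtInfinity_equiv_spanier F N k
  exact ⟨e ≪≫ₗ e' ≪≫ₗ e''.symm⟩

theorem mainTheorem7 {m n : ℕ}
    (M : Type u) [TopologicalSpace M] [T2Space M] [SecondCountableTopology M]
    [ChartedSpace (EuclideanSpace ℝ (Fin m)) M]
    [IsManifold 𝓘(ℝ, EuclideanSpace ℝ (Fin m)) ∞ M]
    (N : Type v) [TopologicalSpace N] [T2Space N] [SecondCountableTopology N]
    [ChartedSpace (EuclideanSpace ℝ (Fin n)) N]
    [IsManifold 𝓘(ℝ, EuclideanSpace ℝ (Fin n)) ∞ N]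
    (h : Nonempty (M ≃ₜ N)) (k : ℕ) :
    Cardinal.lift.{v} (DiffForm.c (EuclideanSpace ℝ (Fin m)) M k) =
      Cardinal.lift.{u} (DiffForm.c (EuclideanSpace ℝ (Fin n)) N k) := by
  obtain ⟨h⟩ := h
  obtain ⟨e⟩ := mainTheorem7_general (E := EuclideanSpace ℝ (Fin m))
    (F := EuclideanSpace ℝ (Fin n)) h k
  exact e.lift_rank_eq
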